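/- For a subgroup $S$ of a finite group $G$ let $I_G(S)=\{g^{-1}s^{-1}gs \mid g\in G,\ s\in S\}$ and let $[G,S]$ be the subgroup generated by $I_G(S)$. The rank of a finite group is the least positive integer $r$ such that each of its subgroups can be generated by $r$ elements. Let $q$ be a prime with $q\equiv 3 \pmod 8$. (1) For every odd positive integer $e$ we have $q^e\equiv 3\pmod 8$, and for $G=PSL_2(q^e)$ and every Sylow $2$-subgroup $P$ of $G$ the following hold: $P$ is elementary abelian of order $4$; every subgroup of $G$ generated by a subset of $I_G(P)$ can be generated by $3$ elements; $[G,P]=G$ if $q^e\neq 3$; and both $G$ and $[G,P]$ have rank at least $e$. (2) Consequently, for fixed $q$, the rank of $[G,P]$ for $G=PSL_2(q^e)$ is unbounded as $e$ runs over the odd positive integers. (3) Consequently, there is no function $f:\mathbb N\to\mathbb N$ such that, for all positive integers $r$, all finite groups $G$ and all Sylow $2$-subgroups $P$ of $G$ such that every subgroup generated by a subset of $I_G(P)$ can be generated by $r$ elements, the rank of $[G,P]$ is at most $f(r)$. That is, the theorem that for a prime $p$ and a $p$-soluble finite group $G$ with a Sylow $p$-subgroup $P$ this hypothesis (with Sylow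 $p$-subgroup $P$) bounds the rank of $[G,P]$ in terms of $r$ fails for $p=2$ if the assumption of $p$-solubility is dropped. -/

import Mathlib

/-- `I_G(S)`: the set of commutators `[g, s] = g⁻¹ g^s`, where `g ∈ G`, `s ∈ S` and
`g^s = s⁻¹ g s`. -/
def commSet {G : Type*} [Group G] (S : Subgroup G) : Set G :=
  {x | ∃ g : G, ∃ s ∈ S, x = g⁻¹ * (s⁻¹ * g * s)}

/-- The subgroup generated by `I_G(S)` is Mathlib's commutator subgroup `[G, S]`. -/
theorem closure_commSet {G : Type*} [Group G] (S : Subgroup G) :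
    Subgroup.closure (commSet S) = ⁅(⊤ : Subgroup G), S⁆ := by
  rw [Subgroup.commutator_def]
  congr 1
  ext x
  constructor
  · rintro ⟨g, s, hs, rfl⟩
    exact ⟨g⁻¹, Subgroup.mem_top _, s⁻¹, S.inv_mem hs, by simp [commutatorElement_def, mul_assoc]⟩
  · rintro ⟨g, -, s, hs, rfl⟩
    exact ⟨g⁻¹, s⁻¹, S.inv_mem hs, by simp [commutatorElement_def, mul_assoc]⟩

/-- The subgroup `H` can be generated by `r` elements (repetitions allowed). -/
def GeneratedBy {G : Type*} [Group G] (H : Subgroup G) (r : ℕ) : Prop :=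
  ∃ a : Fin r → G, Subgroup.closure (Set.range a) = H

/-- Every subgroup of `G` generated by a subset of `I_G(P)` can be generated by `r` elements. -/
def CommutatorsGeneratedBy {G : Type*} [Group G] (P : Subgroup G) (r : ℕ) : Prop :=
  ∀ X : Set G, X ⊆ commSet P → GeneratedBy (Subgroup.closure X) r

/-- The rank of a finite group `G`: the least positive integer `r` such that every subgroup of `G`
can be generated by `r` elements. -/
noncomputable def groupRank (G : Type*) [Group G] [Finite G] : ℕ :=
  sInf {r : ℕ | 0 < r ∧ ∀ H : Subgroup G, GeneratedBy H r}

/-- The group `PSL₂(q^e)`, over the field with `q^e` elements (for `e ≠ 0`). -/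
abbrev PSL2 (q e : ℕ) [Fact q.Prime] : Type :=
  Matrix.ProjectiveSpecialLinearGroup (Fin 2) (GaloisField q e)

instance PSL2.instFinite (q e : ℕ) [Fact q.Prime] : Finite (PSL2 q e) :=
  inferInstanceAs (Finite (_ ⧸ _))

/-! ### Entries, commuting elements and centralizers in `SL(2, F)`. -/

namespace SpecialLinearTwo

open Matrix MatrixGroups

variable {F : Type*} [Field F]

/-! The rank is large because the unitriangular matrices embed the additive group of the field, of
dimension `e` over `ZMod q`, in `PSL₂(q^e)` (`finrank_le_groupRank`), and `[G, P]` is a nontrivial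
normal subgroup of a simple group when `q^e ≠ 3`. The point is that subgroups generated by elements
of `I_G(P)` still need at most 3 generators.

Let `H` be the preimage in `SL(2, F)` of such a subgroup; it contains `-1`. By
`exists_fixesLine_or_generators`, either `H` fixes a line of `F²`, or `H` is generated by `-1` and
three elements.

If a line `L` is fixed, the hypothesis on commutators enters. A lift `σ` of an involution `s` of `P`
satisfies `σ² = -1` and inverts every lift `ξ` of a commutator `[g, s]`. So `ξ` fixes `L` and `σL`,
which differ because `-1` is not a square: the `[g, s]` lie in one cyclic diagonal torus. Since `P`
has three involutions, three cyclic groups generate everything (`generatedBy_of_fixesLine`).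

If no line is fixed, a class equation in the style of Dickson applies. Commuting is transitive on
noncentral elements, so their centralizers partition the noncentral part of `H`. Without parabolic
elements these centralizers are cyclic of index at most 2 in their normalizers, and the equation
yields a centralizer `C` with `|H| < 2|C|²`. Then `C` and one element outside its normalizer
generate a subgroup of index at most 3, and one more element suffices; if `C` is normal, its index
is at most 2.

With a parabolic element, normalize so that `H` contains the unitriangular matrix with entry `1` and
moves infinity to `0`. The equation forces the orbit of infinity to have exactly one more point than
the unipotent group `A` of `H` has elements (`relIndex_borel`). Hence `A` is closed under a twisted
inversion, is a subfield by Hua's identity, and `H` is `SL₂` of it, generated by a transvection, the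
Weyl element and a diagonal matrix.

That `|F|` is `3` modulo `8` makes `-1` and `2` nonsquares; the latter excludes elements of order 4
in `PSL₂`, so `P` is elementary abelian. -/

theorem mul_00 (x y : SL(2, F)) : (x * y) 0 0 = x 0 0 * y 0 0 + x 0 1 * y 1 0 := by
  simp [Matrix.mul_apply, Fin.sum_univ_two]

theorem mul_01 (x y : SL(2, F)) : (x * y) 0 1 = x 0 0 * y 0 1 + x 0 1 * y 1 1 := by
  simp [Matrix.mul_apply, Fin.sum_univ_two]

theorem mul_10 (x y : SL(2, F)) : (x * y) 1 0 = x 1 0 * y 0 0 + x 1 1 * y 1 0 := by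
  simp [Matrix.mul_apply, Fin.sum_univ_two]

theorem mul_11 (x y : SL(2, F)) : (x * y) 1 1 = x 1 0 * y 0 1 + x 1 1 * y 1 1 := by
  simp [Matrix.mul_apply, Fin.sum_univ_two]

theorem inv_00 (x : SL(2, F)) : x⁻¹ 0 0 = x 1 1 := by
  simp [SpecialLinearGroup.SL2_inv_expl]

theorem inv_01 (x : SL(2, F)) : x⁻¹ 0 1 = -x 0 1 := by
  simp [SpecialLinearGroup.SL2_inv_expl]

theorem inv_10 (x : SL(2, F)) : x⁻¹ 1 0 = -x 1 0 := by
  simp [SpecialLinearGroup.SL2_inv_expl]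

theorem inv_11 (x : SL(2, F)) : x⁻¹ 1 1 = x 0 0 := by
  simp [SpecialLinearGroup.SL2_inv_expl]

theorem det_entries (x : SL(2, F)) : x 0 0 * x 1 1 - x 0 1 * x 1 0 = 1 := by
  have := x.det_coe
  rwa [Matrix.det_fin_two] at this

theorem ext_entries {x y : SL(2, F)} (h00 : x 0 0 = y 0 0) (h01 : x 0 1 = y 0 1)
    (h10 : x 1 0 = y 1 0) (h11 : x 1 1 = y 1 1) : x = y := by
  ext i j
  fin_cases i <;> fin_cases j <;> assumption

/-- The element of `SL₂` with the given entries. -/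
def mk (a b c d : F) (h : a * d - b * c = 1) : SL(2, F) :=
  ⟨!![a, b; c, d], by rw [Matrix.det_fin_two_of, h]⟩

section mk
variable (a b c d : F) (h : a * d - b * c = 1)
@[simp] theorem mk_00 : mk a b c d h 0 0 = a := rfl
@[simp] theorem mk_01 : mk a b c d h 0 1 = b := rfl
@[simp] theorem mk_10 : mk a b c d h 1 0 = c := rfl
@[simp] theorem mk_11 : mk a b c d h 1 1 = d := rfl
end mk

@[simp] theorem one_00 : (1 : SL(2, F)) 0 0 = 1 := rfl
@[simp] theorem one_01 : (1 : SL(2, F)) 0 1 = 0 := rfl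
@[simp] theorem one_10 : (1 : SL(2, F)) 1 0 = 0 := rfl
@[simp] theorem one_11 : (1 : SL(2, F)) 1 1 = 1 := rfl
@[simp] theorem neg_ij (x : SL(2, F)) (i j : Fin 2) : (-x) i j = -x i j := rfl

/-- The central elements `1` and `-1`. -/
def Scalar (x : SL(2, F)) : Prop := x = 1 ∨ x = -1

theorem scalar_iff {x : SL(2, F)} : Scalar x ↔ x 0 1 = 0 ∧ x 1 0 = 0 ∧ x 0 0 = x 1 1 := by
  constructor
  · rintro (rfl | rfl) <;> simp
  · rintro ⟨h1, h2, h3⟩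
    have hd := det_entries x
    have : (x 0 0 - 1) * (x 0 0 + 1) = 0 := by rw [h1, h2, ← h3] at hd; linear_combination hd
    rcases mul_eq_zero.1 this with h | h
    · left
      apply ext_entries <;> simp [h1, h2, ← h3] <;> linear_combination h
    · right
      apply ext_entries <;> simp [h1, h2, ← h3] <;> linear_combination h

theorem not_scalar_iff {x : SL(2, F)} : ¬ Scalar x ↔ x 0 1 ≠ 0 ∨ x 1 0 ≠ 0 ∨ x 0 0 - x 1 1 ≠ 0 := by
  rw [scalar_iff, sub_ne_zero]
  tauto

/-- Modulo scalar matrices, `x` is the vector `(x 0 1, x 1 0, x 0 0 - x 1 1)`, and two matrices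
commute exactly when their vectors are parallel. Transitivity of commuting is then transitivity of
parallelism through a nonzero vector. -/
theorem commute_iff {x y : SL(2, F)} : Commute x y ↔ x 0 1 * y 1 0 = y 0 1 * x 1 0 ∧
    (y 0 0 - y 1 1) * x 0 1 = (x 0 0 - x 1 1) * y 0 1 ∧
    (y 0 0 - y 1 1) * x 1 0 = (x 0 0 - x 1 1) * y 1 0 := by
  constructor
  · intro h
    have h00 := congrArg (fun z : SL(2, F) => z 0 0) h.eq
    have h01 := congrArg (fun z : SL(2, F) => z 0 1) h.eq
    have h10 := congrArg (fun z : SL(2, F) => z 1 0) h.eq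
    simp only [mul_00, mul_01, mul_10] at h00 h01 h10
    refine ⟨?_, ?_, ?_⟩
    · linear_combination h00
    · linear_combination -h01
    · linear_combination h10
  · rintro ⟨h1, h2, h3⟩
    apply ext_entries <;> simp only [mul_00, mul_01, mul_10, mul_11]
    · linear_combination h1
    · linear_combination -h2
    · linear_combination h3
    · linear_combination -h1

theorem Scalar.commute {x : SL(2, F)} (h : Scalar x) (y : SL(2, F)) : Commute x y := by
  rcases h with rfl | rfl
  · exact Commute.one_left y
  · exact (Commute.one_left y).neg_left

theorem Scalar.conj_iff {x : SL(2, F)} (g : SL(2, F)) : Scalar (g * x * g⁻¹) ↔ Scalar x := by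
  unfold Scalar
  rw [mul_inv_eq_iff_eq_mul, mul_inv_eq_iff_eq_mul]
  simp only [one_mul, mul_eq_left, neg_mul]
  refine or_congr Iff.rfl ?_
  rw [← mul_neg_one g, mul_right_inj]

/-- Commuting is transitive through a noncentral element. -/
theorem commute_trans {x y z : SL(2, F)} (hy : ¬ Scalar y) (hxy : Commute x y)
    (hyz : Commute y z) : Commute x z := by
  rw [commute_iff] at *
  rw [not_scalar_iff] at hy
  obtain ⟨a1, a2, a3⟩ := hxy
  obtain ⟨b1, b2, b3⟩ := hyz
  rcases hy with h | h | h
  · refine ⟨?_, ?_, ?_⟩ <;> apply mul_left_cancel₀ h <;> grind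
  · refine ⟨?_, ?_, ?_⟩ <;> apply mul_left_cancel₀ h <;> grind
  · refine ⟨?_, ?_, ?_⟩ <;> apply mul_left_cancel₀ h <;> grind

theorem exists_linear_of_commute {x y : SL(2, F)} (hx : ¬ Scalar x) (h : Commute x y) :
    ∃ α β : F, y 0 0 = α * x 0 0 + β ∧ y 0 1 = α * x 0 1 ∧ y 1 0 = α * x 1 0 ∧
      y 1 1 = α * x 1 1 + β := by
  rw [commute_iff] at h
  rw [not_scalar_iff] at hx
  obtain ⟨h1, h2, h3⟩ := h
  rcases hx with h | h | h
  · refine ⟨y 0 1 / x 0 1, y 0 0 - y 0 1 / x 0 1 * x 0 0, by ring, by field_simp, ?_, ?_⟩ <;>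
      field_simp <;> grind
  · refine ⟨y 1 0 / x 1 0, y 0 0 - y 1 0 / x 1 0 * x 0 0, by ring, ?_, by field_simp, ?_⟩ <;>
      field_simp <;> grind
  · refine ⟨(y 0 0 - y 1 1) / (x 0 0 - x 1 1), y 0 0 - (y 0 0 - y 1 1) / (x 0 0 - x 1 1) * x 0 0,
      by ring, ?_, ?_, ?_⟩ <;> field_simp <;> grind

/-- Trace of a `2 × 2` matrix of determinant one. -/
def tr (x : SL(2, F)) : F := x 0 0 + x 1 1

theorem tr_conj (g x : SL(2, F)) : tr (g * x * g⁻¹) = tr x := by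
  have hd := det_entries g
  simp only [tr, mul_00, mul_01, mul_10, mul_11, inv_00, inv_01, inv_10, inv_11]
  linear_combination (x 0 0 + x 1 1) * hd

/-- Noncentral elements with trace `±2`. -/
def Parabolic (x : SL(2, F)) : Prop := ¬ Scalar x ∧ tr x ^ 2 = 4

/-- A conjugate of a semisimple element `x` that commutes with `x` is `x` or `x⁻¹`. -/
theorem eq_or_eq_inv_of_commute {x y : SL(2, F)} (h2 : (2 : F) ≠ 0) (hx : ¬ Scalar x)
    (ht : tr x ^ 2 ≠ 4) (hxy : Commute x y) (htr : tr y = tr x) : y = x ∨ y = x⁻¹ := by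
  obtain ⟨α, β, e1, e2, e3, e4⟩ := exists_linear_of_commute hx hxy
  have hdx := det_entries x
  have hdy := det_entries y
  unfold tr at ht htr
  rw [e1, e2, e3, e4] at hdy
  rw [e1, e4] at htr
  have hβ : 2 * β = (x 0 0 + x 1 1) * (1 - α) := by linear_combination htr
  -- Compare the determinants of `x` and of `α x + β`, with `β` eliminated through the trace. The
  -- root `α = -1` gives `tr x - x`, which is `x⁻¹` by Cayley–Hamilton.
  have key : (α - 1) * (α + 1) * ((x 0 0 + x 1 1) ^ 2 - 4) = 0 := by
    linear_combination -4 * hdy + 4 * α ^ 2 * hdx +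
      (2 * α * (x 0 0 + x 1 1) + 2 * β + (x 0 0 + x 1 1) * (1 - α)) * hβ
  rcases mul_eq_zero.1 key with h | h
  · rcases mul_eq_zero.1 h with h | h
    · left
      have hα : α = 1 := by linear_combination h
      have hb : β = 0 := by
        rw [hα] at hβ; simpa [h2] using hβ
      apply ext_entries <;> simp [*]
    · right
      have hα : α = -1 := by linear_combination h
      have hb : β = x 0 0 + x 1 1 := by
        apply mul_left_cancel₀ h2; rw [hβ, hα]; ring
      apply ext_entries <;> simp only [inv_00, inv_01, inv_10, inv_11, *] <;> ring
  · exact absurd (by linear_combination h) ht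

theorem commute_of_conj_eq {x n : SL(2, F)} (h : n * x * n⁻¹ = x) : Commute x n := by
  rw [mul_inv_eq_iff_eq_mul] at h
  exact h.symm

/-- The product of two elements inverting `x` commutes with `x`. -/
theorem commute_of_inverting {x m n : SL(2, F)} (hm : m * x * m⁻¹ = x⁻¹)
    (hn : n * x * n⁻¹ = x⁻¹) : Commute x (m⁻¹ * n) := by
  apply commute_of_conj_eq
  calc m⁻¹ * n * x * (m⁻¹ * n)⁻¹ = m⁻¹ * (n * x * n⁻¹) * m := by group
    _ = m⁻¹ * (m * x * m⁻¹) * m := by rw [hn, hm]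
    _ = x := by group

/-- The centralizer of a semisimple noncentral element is cyclic. -/
theorem isCyclic_centralizer [Finite F] {x : SL(2, F)} (hx : ¬ Scalar x)
    (ht : tr x ^ 2 ≠ 4) : IsCyclic (Subgroup.centralizer {x}) := by
  classical
  let K := AlgebraicClosure F
  let ι : F →+* K := algebraMap F K
  have hι : Function.Injective ι := (algebraMap F K).injective
  let P : Polynomial K := Polynomial.X ^ 2 - Polynomial.C (ι (tr x)) * Polynomial.X + 1
  have hP : P.degree = 2 := by
    have := Polynomial.degree_quadratic (a := (1 : K)) (b := -ι (tr x)) (c := 1) one_ne_zero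
    rw [← this]
    congr 1
    simp only [P, map_one, map_neg]
    ring
  obtain ⟨ρ, hρ⟩ := IsAlgClosed.exists_root P (by rw [hP]; norm_num)
  have hρ' : ρ ^ 2 - ι (tr x) * ρ + 1 = 0 := by
    simpa [P, Polynomial.IsRoot] using hρ
  have hex : ∀ y : Subgroup.centralizer {x}, ∃ α β : F, y.1 0 0 = α * x 0 0 + β ∧
      y.1 0 1 = α * x 0 1 ∧ y.1 1 0 = α * x 1 0 ∧ y.1 1 1 = α * x 1 1 + β := fun y =>
    exists_linear_of_commute hx (Subgroup.mem_centralizer_singleton_iff.1 y.2).symm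
  choose α β h00 h01 h10 h11 using hex
  have huniq : ∀ a b a' b' : F, a * x 0 0 + b = a' * x 0 0 + b' → a * x 0 1 = a' * x 0 1 →
      a * x 1 0 = a' * x 1 0 → a * x 1 1 + b = a' * x 1 1 + b' → a = a' ∧ b = b' := by
    intro a b a' b' e1 e2 e3 e4
    have ha : a = a' := by
      rcases not_scalar_iff.1 hx with h | h | h
      · exact mul_right_cancel₀ h e2
      · exact mul_right_cancel₀ h e3
      · apply mul_right_cancel₀ h; linear_combination e1 - e4
    refine ⟨ha, ?_⟩
    rw [ha] at e1
    exact add_left_cancel e1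
  have hdx := det_entries x
  have hdetx : ∀ y, α y ^ 2 + α y * β y * tr x + β y ^ 2 = 1 := by
    intro y
    have := det_entries y.1
    rw [h00, h01, h10, h11] at this
    unfold tr
    linear_combination this - α y ^ 2 * hdx
  -- The centralizer consists of elements of the algebra `F[x]`; `φ` evaluates `α x + β` at the
  -- eigenvalue `ρ` of `x`. Finite groups embedding in a field's multiplicative monoid are cyclic.
  let φ : Subgroup.centralizer {x} →* K :=
    { toFun := fun y => ι (α y) * ρ + ι (β y)
      map_one' := by
        obtain ⟨ha, hb⟩ := huniq (α 1) (β 1) 0 1 (by rw [← h00]; simp) (by rw [← h01]; simp)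
          (by rw [← h10]; simp) (by rw [← h11]; simp)
        simp [ha, hb]
      map_mul' := by
        intro y z
        obtain ⟨ha, hb⟩ := huniq (α (y * z)) (β (y * z))
          (α y * β z + α z * β y + α y * α z * tr x) (β y * β z - α y * α z)
          (by rw [← h00, Subgroup.coe_mul, mul_00, h00, h00, h01, h10]; unfold tr
              linear_combination -(α y * α z * hdx))
          (by rw [← h01, Subgroup.coe_mul, mul_01, h00, h11, h01, h01]; unfold tr; ring)
          (by rw [← h10, Subgroup.coe_mul, mul_10, h00, h11, h10, h10]; unfold tr; ring)
          (by rw [← h11, Subgroup.coe_mul, mul_11, h11, h11, h01, h10]; unfold tr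
              linear_combination -(α y * α z * hdx))
        rw [ha, hb]
        simp only [map_add, map_mul, map_sub]
        linear_combination ι (α y) * ι (α z) * hρ' * (-1) }
  refine isCyclic_of_injective_ringHom φ ?_
  rw [injective_iff_map_eq_one]
  intro y hy
  have hy : ι (α y) * ρ + ι (β y) = 1 := hy
  have hd := congrArg ι (hdetx y)
  simp only [map_add, map_mul, map_pow, map_one] at hd
  -- The values at the two eigenvalues multiply to the determinant `1`, so the value at the other
  -- eigenvalue `tr x - ρ` is also `1`. The eigenvalues differ because `tr x ^ 2 ≠ 4`, whence `α =
  -- 0` and `β = 1`.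
  have hconj : ι (α y) * (ι (tr x) - ρ) + ι (β y) = 1 := by
    linear_combination (-ι (α y) * (ι (tr x) - ρ) - ι (β y)) * hy + hd + ι (α y) ^ 2 * hρ' * (-1)
  have hz : ι (α y) * (ι (tr x) - 2 * ρ) = 0 := by linear_combination hconj - hy
  have hne : ι (tr x) - 2 * ρ ≠ 0 := by
    intro h
    apply ht
    apply hι
    rw [map_pow, map_ofNat]
    linear_combination (ι (tr x) + 2 * ρ) * h - 4 * hρ' - 4 * ρ * h
  have hα : α y = 0 := by
    apply hι
    rw [map_zero]
    exact (mul_eq_zero.1 hz).resolve_right hne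
  have hβ : β y = 1 := by
    apply hι
    rw [map_one, ← hy, hα]
    simp
  apply Subtype.ext
  apply ext_entries <;> simp [h00, h01, h10, h11, hα, hβ]

end SpecialLinearTwo

/-! ### Counting classes in groups where commuting is transitive outside `Z`. -/

/-- Elements of a group outside `Z`, where commuting is transitive outside `Z`. -/
structure CommuteTransitive {K : Type*} [Group K] (Z : K → Prop) : Prop where
  conj_iff : ∀ g x, Z (g * x * g⁻¹) ↔ Z x
  trans : ∀ {x y z : K}, ¬ Z y → Commute x y → Commute y z → Commute x z

namespace CommuteTransitive

variable {K : Type*} [Group K] {Z : K → Prop}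

/-- The elements outside `Z` having a conjugate that commutes with `x`. -/
def fusion (Z : K → Prop) (x : K) : Set K := {y | ¬ Z y ∧ ∃ g, Commute (g * y * g⁻¹) x}

/-- The elements that conjugate `x` to an element commuting with `x`; if commuting is transitive
outside `Z`, this is the normalizer of the centralizer of `x`. -/
def normSet (x : K) : Set K := {g | Commute (g * x * g⁻¹) x}

theorem _root_.Commute.conj_conj {x y : K} (g : K) (h : Commute x y) :
    Commute (g * x * g⁻¹) (g * y * g⁻¹) := by
  rw [commute_iff_eq]
  have := h.eq
  calc g * x * g⁻¹ * (g * y * g⁻¹) = g * (x * y) * g⁻¹ := by group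
    _ = g * (y * x) * g⁻¹ := by rw [this]
    _ = _ := by group

theorem mem_fusion_self {x : K} (hx : ¬ Z x) : x ∈ fusion Z x := ⟨hx, 1, by simp⟩

/-- Choose for each `y` in the class an element `γ y` conjugating it into the centralizer of `x`.
Then `(g, c) ↦ (y, γ y * g)` with `y = g c g⁻¹` is a bijection, transitivity ensuring that `γ y * g`
normalizes the centralizer. -/
theorem card_fusion_mul_card_normSet (h : CommuteTransitive Z) {x : K} (hx : ¬ Z x) :
    (fusion Z x).ncard * (normSet x).ncard = Nat.card K * {c | Commute c x ∧ ¬ Z c}.ncard := by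
  rw [← Nat.card_coe_set_eq, ← Nat.card_coe_set_eq, ← Nat.card_coe_set_eq, ← Nat.card_prod,
    ← Nat.card_prod]
  have hg : ∀ y : fusion Z x, ∃ g : K, Commute (g * y.1 * g⁻¹) x := fun y => y.2.2
  choose γ hγ using hg
  symm
  have hy : ∀ p : K × {c | Commute c x ∧ ¬ Z c}, p.1 * p.2.1 * p.1⁻¹ ∈ fusion Z x := by
    rintro ⟨g, c, hc, hcZ⟩
    exact ⟨by rwa [h.conj_iff], g⁻¹, by simpa [mul_assoc] using hc⟩
  have hn : ∀ p : K × {c | Commute c x ∧ ¬ Z c}, γ ⟨_, hy p⟩ * p.1 ∈ normSet x := by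
    intro p
    obtain ⟨g, c, hc, hcZ⟩ := p
    have h1 := hγ ⟨_, hy (g, ⟨c, hc, hcZ⟩)⟩
    set k := γ ⟨_, hy (g, ⟨c, hc, hcZ⟩)⟩
    have h2 := (hc.conj_conj (k * g)).symm
    refine h.trans (by rwa [h.conj_iff]) h2 ?_
    convert h1 using 1
    simp [mul_assoc]
  have hc : ∀ p : fusion Z x × normSet x,
      ((γ p.1)⁻¹ * p.2.1)⁻¹ * p.1.1 * ((γ p.1)⁻¹ * p.2.1) ∈ {c | Commute c x ∧ ¬ Z c} := by
    rintro ⟨y, n, hn⟩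
    have h1 := h.trans hx (hγ y) (Commute.symm hn)
    refine ⟨?_, ?_⟩
    · convert h1.conj_conj n⁻¹ using 1 <;> simp [mul_assoc]
    · have := (h.conj_iff ((γ y)⁻¹ * n)⁻¹ y.1).not.2 y.2.1
      simpa using this
  refine Nat.card_congr
    { toFun := fun p => (⟨_, hy p⟩, ⟨_, hn p⟩)
      invFun := fun p => ((γ p.1)⁻¹ * p.2.1, ⟨_, hc p⟩)
      left_inv := ?_
      right_inv := ?_ }
  · rintro ⟨g, c, hc⟩
    ext <;> simp [mul_assoc]
  · rintro ⟨y, n⟩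
    have e : (γ y)⁻¹ * n.1 * (((γ y)⁻¹ * n.1)⁻¹ * y.1 * ((γ y)⁻¹ * n.1)) * ((γ y)⁻¹ * n.1)⁻¹ = y.1 := by
      group
    have e' : (⟨_, hy ((γ y)⁻¹ * n.1, ⟨_, hc (y, n)⟩)⟩ : fusion Z x) = y := Subtype.ext e
    ext
    · exact e
    · change γ ⟨_, hy ((γ y)⁻¹ * n.1, ⟨_, hc (y, n)⟩)⟩ * ((γ y)⁻¹ * n.1) = n.1
      rw [e']
      simp

theorem disjoint_fusion (h : CommuteTransitive Z) {x y : K} (hy : ¬ Z y)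
    (hxy : y ∉ fusion Z x) : Disjoint (fusion Z x) (fusion Z y) := by
  rw [Set.disjoint_left]
  rintro z ⟨hz, a, ha⟩ ⟨-, b, hb⟩
  refine hxy ⟨hy, a * b⁻¹, ?_⟩
  refine h.trans ((h.conj_iff a z).not.2 hz) ?_ ha
  convert (hb.conj_conj (a * b⁻¹)).symm using 1
  simp [mul_assoc]

/-- A set of representatives of the fusion classes, extending a given independent set. -/
theorem exists_representatives [Finite K] (h : CommuteTransitive Z) (S : Finset K)
    (hS : ∀ x ∈ S, ¬ Z x) (hS' : (S : Set K).PairwiseDisjoint (fusion Z)) :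
    ∃ R : Finset K, S ⊆ R ∧ (∀ x ∈ R, ¬ Z x) ∧ (R : Set K).PairwiseDisjoint (fusion Z) ∧
      ∑ x ∈ R, (fusion Z x).ncard = {x | ¬ Z x}.ncard := by
  classical
  have := Fintype.ofFinite K
  -- A maximal family with disjoint classes covers everything: by `disjoint_fusion` an uncovered
  -- element could be added.
  obtain ⟨R, hSR, hR⟩ := (Set.toFinite {R : Finset K | (∀ x ∈ R, ¬ Z x) ∧
    (R : Set K).PairwiseDisjoint (fusion Z)}).exists_le_maximal ⟨hS, hS'⟩
  refine ⟨R, hSR, hR.prop.1, hR.prop.2, ?_⟩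
  have hcov : {x | ¬ Z x} = ⋃ x ∈ R, fusion Z x := by
    ext y
    simp only [Set.mem_ofPred_eq, Set.mem_iUnion, exists_prop]
    refine ⟨fun hy => ?_, fun ⟨x, _, hx⟩ => hx.1⟩
    by_contra! hcon
    have hins : insert y R ≤ R := by
      apply hR.le_of_ge ⟨?_, ?_⟩ (Finset.subset_insert y R)
      · intro x hx
        rcases Finset.mem_insert.1 hx with rfl | hx
        · exact hy
        · exact hR.prop.1 x hx
      · rw [Finset.coe_insert]
        refine hR.prop.2.insert fun x hx _ => ?_
        exact (h.disjoint_fusion hy (hcon x hx)).symm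
    exact hcon y (hins (Finset.mem_insert_self y R)) (mem_fusion_self hy)
  have hfin : (⋃ x ∈ R, fusion Z x).toFinset = R.biUnion fun x => (fusion Z x).toFinset := by
    ext y; simp
  rw [hcov, Set.ncard_eq_toFinset_card', hfin, Finset.card_biUnion]
  · exact Finset.sum_congr rfl fun x _ => Set.ncard_eq_toFinset_card' _
  · intro x hx y hy hxy
    exact Set.disjoint_toFinset.2 (hR.prop.2 hx hy hxy)

end CommuteTransitive

/-! ### Arithmetic of the class equations. -/

namespace ClassEquation

theorem inv_bounds {t : ℕ} (ht : 2 ≤ t) : 0 < 1 / (t : ℚ) ∧ 1 / (t : ℚ) ≤ 1 / 2 := by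
  have : (2 : ℚ) ≤ t := by exact_mod_cast ht
  refine ⟨by positivity, ?_⟩
  apply one_div_le_one_div_of_le <;> linarith

theorem inv_le_inv {s t : ℕ} (hs : 0 < s) (ht : s ≤ t) : 1 / (t : ℚ) ≤ 1 / s := by
  have : (s : ℚ) ≤ t := by exact_mod_cast ht
  have : (0 : ℚ) < s := by exact_mod_cast hs
  apply one_div_le_one_div_of_le <;> linarith

theorem inv_le_of_sq_le {t h : ℕ} (ht : 0 < t) (hh : 4 * t ^ 2 ≤ h) :
    1 / (h : ℚ) ≤ (1 / t) ^ 2 / 4 := by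
  have h1 : (4 * t ^ 2 : ℚ) ≤ h := by exact_mod_cast hh
  have : (0 : ℚ) < t := by exact_mod_cast ht
  calc 1 / (h : ℚ) ≤ 1 / (4 * t ^ 2) := by
        apply one_div_le_one_div_of_le _ h1; positivity
    _ = _ := by field_simp

/-- No solution with two classes, the first being self-normalizing. -/
theorem no_mixed_pair {a b h : ℕ} (ha : 2 ≤ a) (hb : 2 ≤ b) (ha' : 4 * a ^ 2 ≤ h)
    (hb' : 4 * b ^ 2 ≤ h) (H : (1 - 1 / (a : ℚ)) + (1 - 1 / (b : ℚ)) / 2 = 1 - 1 / h) : False := by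
  have hA := inv_le_of_sq_le (by omega) ha'
  have hB := inv_le_of_sq_le (by omega) hb'
  obtain ⟨b1, b2⟩ := inv_bounds hb
  have hh : 0 < 1 / (h : ℚ) := (inv_bounds (by nlinarith)).1
  have ha4 : a < 4 := by
    by_contra hc
    have := inv_le_inv (s := 4) (by norm_num) (not_lt.1 hc)
    push_cast at this H
    linarith
  -- Here `a = 2` would give `h = 2 * b`, and `a = 3` leaves only `b = 2`, `h = 12`; both orders are
  -- too small for the assumed bounds.
  interval_cases a
  · push_cast at *
    nlinarith
  · have hb3 : b < 3 := by
      by_contra hc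
      have := inv_le_inv (s := 3) (by norm_num) (not_lt.1 hc)
      push_cast at this H
      linarith
    interval_cases b
    push_cast at *
    linarith

/-- No solution with three classes, each of index two in its normalizer. -/
theorem no_triple {a b c h : ℕ} (ha : 2 ≤ a) (hab : a ≤ b) (hbc : b ≤ c) (hc : 4 * c ^ 2 ≤ h)
    (H : (1 - 1 / (a : ℚ)) / 2 + (1 - 1 / (b : ℚ)) / 2 + (1 - 1 / (c : ℚ)) / 2 = 1 - 1 / h) :
    False := by
  have hC := inv_le_of_sq_le (by omega) hc
  have hh : 0 < 1 / (h : ℚ) := (inv_bounds (by nlinarith)).1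
  obtain ⟨c1, c2⟩ := inv_bounds (ha.trans (hab.trans hbc))
  have iab := inv_le_inv (by omega) hab
  have ibc := inv_le_inv (by omega) hbc
  have ha3 : a < 3 := by
    by_contra hcon
    have := inv_le_inv (s := 3) (by norm_num) (not_lt.1 hcon)
    push_cast at *
    linarith
  -- With `a = 2`: `b = 2` gives the dihedral order `h = 2 * c`, while `b = 3` with `c = 3, 4, 5`
  -- gives `h = 12, 24, 60`. All are below `4 * c ^ 2`.
  interval_cases a
  have hb4 : b < 4 := by
    by_contra hcon
    have := inv_le_inv (s := 4) (by norm_num) (not_lt.1 hcon)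
    push_cast at *
    linarith
  interval_cases b
  · push_cast at *
    nlinarith
  · have hc6 : c < 6 := by
      by_contra hcon
      have := inv_le_inv (s := 6) (by norm_num) (not_lt.1 hcon)
      push_cast at *
      linarith
    interval_cases c <;> push_cast at * <;> linarith

theorem no_triple' {a b c h : ℕ} (ha : 2 ≤ a) (hb : 2 ≤ b) (hc : 2 ≤ c) (ha' : 4 * a ^ 2 ≤ h)
    (hb' : 4 * b ^ 2 ≤ h) (hc' : 4 * c ^ 2 ≤ h)
    (H : (1 - 1 / (a : ℚ)) / 2 + (1 - 1 / (b : ℚ)) / 2 + (1 - 1 / (c : ℚ)) / 2 = 1 - 1 / h) :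
    False := by
  rcases le_total a b with h1 | h1 <;> rcases le_total b c with h2 | h2 <;>
    rcases le_total a c with h3 | h3
  · exact no_triple ha h1 h2 hc' H
  · exact no_triple ha h1 h2 hc' H
  · exact no_triple ha h3 h2 hb' (by linarith)
  · exact no_triple hc h3 h1 hb' (by linarith)
  · exact no_triple hb h1 h3 hc' (by linarith)
  · exact no_triple hb h2 h3 ha' (by linarith)
  · exact no_triple hc h2 h1 ha' (by linarith)
  · exact no_triple hc h2 h1 ha' (by linarith)

theorem term_bounds {t e : ℕ} (ht : 2 ≤ t) (he : e = 1 ∨ e = 2) :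
    1 / 4 ≤ (1 - 1 / (t : ℚ)) / e ∧ (e = 1 → 1 / 2 ≤ (1 - 1 / (t : ℚ)) / e) := by
  obtain ⟨h1, h2⟩ := inv_bounds ht
  rcases he with rfl | rfl <;> refine ⟨?_, fun h => ?_⟩ <;> push_cast at * <;> linarith

/-- A finite group partitioned, modulo a centre of order two, into tori which have index at most two
in their normalizers has a torus whose order is large compared to the order of the group. -/
theorem exists_large_torus {ι : Type*} (R : Finset ι) (t e : ι → ℕ) {h : ℕ} (hh : 2 ≤ h)
    (ht : ∀ x ∈ R, 2 ≤ t x) (he : ∀ x ∈ R, e x = 1 ∨ e x = 2)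
    (H : ∑ x ∈ R, (1 - 1 / (t x : ℚ)) / e x = 1 - 1 / h) : ∃ x ∈ R, h < 4 * t x ^ 2 := by
  classical
  by_contra! hcon
  obtain ⟨h1, h2⟩ := inv_bounds hh
  -- Each term is at least `1 / 4`, and at least `1 / 2` when `e = 1`, while the sum is below `1`.
  -- So there are at most three terms, and three terms all have `e = 2`.
  have hcard : R.card < 4 := by
    by_contra hc
    have : (R.card : ℚ) * (1 / 4) ≤ ∑ x ∈ R, (1 - 1 / (t x : ℚ)) / e x := by
      rw [← nsmul_eq_mul]
      exact Finset.card_nsmul_le_sum _ _ _ fun x hx => (term_bounds (ht x hx) (he x hx)).1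
    have h4 : (4 : ℚ) ≤ R.card := by exact_mod_cast not_lt.1 hc
    linarith
  have hcases : R.card = 0 ∨ R.card = 1 ∨ R.card = 2 ∨ R.card = 3 := by omega
  rcases hcases with h0 | h0 | h0 | h0
  · rw [Finset.card_eq_zero.1 h0] at H
    simp only [Finset.sum_empty] at H
    linarith
  · obtain ⟨a, rfl⟩ := Finset.card_eq_one.1 h0
    simp only [Finset.mem_singleton, forall_eq, Finset.sum_singleton] at *
    obtain ⟨a1, a2⟩ := inv_bounds ht
    have := inv_le_of_sq_le (by omega) hcon
    rcases he with he | he <;> rw [he] at H <;> push_cast at H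
    · nlinarith
    · linarith
  · obtain ⟨a, b, hab, rfl⟩ := Finset.card_eq_two.1 h0
    rw [Finset.sum_pair hab] at H
    simp only [Finset.mem_insert, Finset.mem_singleton, forall_eq_or_imp, forall_eq] at *
    obtain ⟨a1, a2⟩ := inv_bounds ht.1
    obtain ⟨b1, b2⟩ := inv_bounds ht.2
    have := inv_le_of_sq_le (by omega) hcon.1
    rcases he with ⟨he | he, he' | he'⟩ <;> rw [he, he'] at H <;> push_cast at H
    · linarith
    · exact no_mixed_pair ht.1 ht.2 hcon.1 hcon.2 (by linarith)
    · exact no_mixed_pair ht.2 ht.1 hcon.2 hcon.1 (by linarith)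
    · nlinarith
  · obtain ⟨a, b, c, hab, hac, hbc, rfl⟩ := Finset.card_eq_three.1 h0
    rw [Finset.sum_insert (by simp [hab, hac]), Finset.sum_pair hbc] at H
    simp only [Finset.mem_insert, Finset.mem_singleton, forall_eq_or_imp, forall_eq] at *
    obtain ⟨ta, tb, tc⟩ := ht
    obtain ⟨ea, eb, ec⟩ := he
    have A := term_bounds ta ea
    have B := term_bounds tb eb
    have C := term_bounds tc ec
    have ea' : e a = 2 := ea.resolve_left fun h => by have := A.2 h; linarith
    have eb' : e b = 2 := eb.resolve_left fun h => by have := B.2 h; linarith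
    have ec' : e c = 2 := ec.resolve_left fun h => by have := C.2 h; linarith
    rw [ea', eb', ec'] at H
    push_cast at H
    exact no_triple' ta tb tc hcon.1 hcon.2.1 hcon.2.2 (by linarith)

/-- With `a = N - 2` and `D = N s - a τ`, the equation says `n D = 2 τ`, and then `D (a n + 2) = 2 N
s`. Since `s < N` and `n > N`, only `D = 1` and `D = 2` remain. -/
theorem arith_aux {N s n τ : ℕ} (hN : 3 ≤ N) (hNodd : Odd N) (hs : Odd s) (hsN : s + 1 ≤ N)
    (hn : N + 1 ≤ n) (E : n * N * τ + 2 * τ = n * (N * s) + 2 * n * τ) (hτ : 2 ≤ τ) :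
    n = N + 1 := by
  obtain ⟨a, rfl⟩ : ∃ a, N = a + 2 := ⟨N - 2, by omega⟩
  obtain ⟨m, rfl⟩ : ∃ m, n = a + 3 + m := ⟨n - (a + 3), by omega⟩
  have hle : a * τ ≤ (a + 2) * s := by
    by_contra hc
    nlinarith
  obtain ⟨D, hD⟩ := Nat.exists_eq_add_of_le hle
  have hnD : (a + 3 + m) * D = 2 * τ := by nlinarith
  have h2 : D * ((a + 1) * (a + 2) + a * m) = 2 * ((a + 2) * s) := by
    rw [hD]; linear_combination a * hnD
  have hD0 : 0 < D := by
    rcases Nat.eq_zero_or_pos D with h | h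
    · rw [h] at hnD; omega
    · exact h
  have hs' : (a + 2) * s ≤ (a + 2) * (a + 1) := Nat.mul_le_mul_left _ (by omega)
  have hD2 : D ≤ 2 := by
    by_contra hc
    have : 3 * ((a + 1) * (a + 2) + a * m) ≤ D * ((a + 1) * (a + 2) + a * m) :=
      Nat.mul_le_mul_right _ (by omega)
    nlinarith
  have hm : m = 0 := by
    interval_cases D
    · have hdvd : a + 2 ∣ 2 * m := by
        have h3 : (a + 2) ∣ a * m := by
          rw [← Nat.dvd_add_right (dvd_mul_left (a + 2) (a + 1))]
          exact ⟨2 * s, by linarith⟩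
        have h4 : (a + 2) ∣ (a + 2) * m := dvd_mul_right _ _
        rw [show (a + 2) * m = a * m + 2 * m by ring] at h4
        exact (Nat.dvd_add_right h3).1 h4
      obtain ⟨j, rfl⟩ := (Nat.coprime_two_right.2 hNodd).dvd_of_dvd_mul_left hdvd
      have h5 : a + 1 + a * j = 2 * s := by
        apply Nat.eq_of_mul_eq_mul_left (show 0 < a + 2 by omega)
        linarith
      obtain ⟨k, rfl⟩ := hs
      obtain ⟨l, hl⟩ := hNodd
      have hj : j < 3 := by
        by_contra hc
        have : a * 3 ≤ a * j := Nat.mul_le_mul_left _ (by omega)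
        omega
      -- Parity rules out `j = 1`. For `j = 2` one is led to `N = 3`, `s = 2`, `n = 10`, the numbers
      -- of `A₅` of order 60, excluded because `s` is odd.
      interval_cases j <;> omega
    · have : a * m = 0 := by nlinarith
      rcases mul_eq_zero.1 this with h | h <;> omega
  omega

/-- The same class equation with one unipotent class: here `N` is the order of a Sylow subgroup `U`
for the characteristic, `t` the order of a complement in its normalizer and `n` the number of
conjugates of `U`. -/
theorem card_conjugates_eq {ι : Type*} (R : Finset ι) (t e : ι → ℕ) {N s n : ℕ} (hN : 3 ≤ N)
    (hNodd : Odd N) (hs : Odd s) (hsN : s + 1 ≤ N) (hn : N + 1 ≤ n)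
    (ht : ∀ x ∈ R, 2 ≤ t x) (he : ∀ x ∈ R, e x = 1 ∨ e x = 2)
    (hmem : s ≠ 1 → ∃ x ∈ R, t x = s)
    (H : ((N : ℚ) - 1) / (N * s) + ∑ x ∈ R, (1 - 1 / (t x : ℚ)) / e x = 1 - 1 / (n * N * s)) :
    n = N + 1 := by
  classical
  have hN' : (3 : ℚ) ≤ N := by exact_mod_cast hN
  have hn' : (N : ℚ) + 1 ≤ n := by exact_mod_cast hn
  have hs0 : 0 < s := hs.pos
  have hs' : (1 : ℚ) ≤ s := by exact_mod_cast hs0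
  have hsum : ∀ R' ⊆ R, (R'.card : ℚ) * (1 / 4) ≤ ∑ x ∈ R', (1 - 1 / (t x : ℚ)) / e x := by
    intro R' hR'
    rw [← nsmul_eq_mul]
    exact Finset.card_nsmul_le_sum _ _ _ fun x hx =>
      (term_bounds (ht x (hR' hx)) (he x (hR' hx))).1
  have hsplit : ((N : ℚ) - 1) / (N * s) = 1 / s - 1 / N * (1 / s) := by field_simp
  have hprod : 1 / ((n : ℚ) * N * s) = 1 / n * (1 / N) * (1 / s) := by field_simp
  rw [hsplit, hprod] at H
  have hNi : 0 < 1 / (N : ℚ) ∧ 1 / (N : ℚ) ≤ 1 / 3 := by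
    refine ⟨by positivity, ?_⟩
    have := inv_le_inv (by norm_num) hN
    exact_mod_cast this
  have hni : 0 < 1 / (n : ℚ) ∧ 1 / (n : ℚ) ≤ 1 / 4 := by
    have h4 : 4 ≤ n := by omega
    refine ⟨by have : (0:ℚ) < n := by linarith
               positivity, ?_⟩
    have := inv_le_inv (by norm_num) h4
    exact_mod_cast this
  set u : ℚ := 1 / N with hu
  set v : ℚ := 1 / n with hv
  have huN : u * N = 1 := by rw [hu]; field_simp
  have hvn : v * n = 1 := by
    rw [hv]
    exact one_div_mul_cancel (by linarith)
  -- For `s = 1` the remaining sum is `u (1 - v) < 1 / 3`, so it is a single term with `e = 2`,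
  -- forcing `N = 3`, `t = 2` and `n = 4`, the numbers of `A₄`. For `s ≠ 1` the torus of the Borel
  -- subgroup is one of the classes, and exactly one further class fits, again with index 2.
  by_cases h1 : s = 1
  · subst h1
    simp only [Nat.cast_one, div_one, mul_one] at H
    rcases R.eq_empty_or_nonempty with rfl | ⟨x, hx⟩
    · simp only [Finset.sum_empty] at H
      nlinarith
    · have hle := hsum R subset_rfl
      have hcard : R.card = 1 := by
        have : 0 < R.card := Finset.card_pos.2 ⟨x, hx⟩
        have h2 : R.card < 2 := by
          by_contra hc
          have h2 : (2 : ℚ) ≤ R.card := by exact_mod_cast not_lt.1 hc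
          nlinarith
        omega
      obtain ⟨y, rfl⟩ := Finset.card_eq_one.1 hcard
      simp only [Finset.sum_singleton] at H
      have hy := term_bounds (ht y (by simp)) (he y (by simp))
      have hu4 : 1 / 4 < u := by nlinarith
      have hN3 : N = 3 := by
        have : N < 4 := by
          by_contra hc
          have := inv_le_inv (s := 4) (by norm_num) (not_lt.1 hc)
          push_cast at this
          linarith
        omega
      have hey : e y = 2 := (he y (by simp)).resolve_left fun h => by
        have := hy.2 h
        nlinarith
      have hty : t y = 2 := by
        have h2 := ht y (by simp)
        have : t y < 3 := by
          by_contra hc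
          have := inv_le_inv (s := 3) (by norm_num) (not_lt.1 hc)
          rw [hey] at H
          push_cast at this H
          nlinarith
        omega
      rw [hey, hty] at H
      subst hN3
      have : (n : ℚ) = 4 := by
        have hv12 : v = 1 / 4 := by
          rw [hu] at H; norm_num at H; linarith
        rw [hv12] at hvn
        linarith
      exact_mod_cast this
  · obtain ⟨x, hx, htx⟩ := hmem h1
    have hs3 : 3 ≤ s := by
      obtain ⟨k, rfl⟩ := hs
      omega
    have hsi : 0 < 1 / (s : ℚ) ∧ 1 / (s : ℚ) ≤ 1 / 3 := by
      refine ⟨by positivity, ?_⟩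
      have := inv_le_inv (by norm_num) hs3
      exact_mod_cast this
    rw [← Finset.add_sum_erase _ _ hx, htx] at H
    set w : ℚ := 1 / s with hw
    have hws : w * s = 1 := by rw [hw]; field_simp
    have huw : 0 < u * w := mul_pos hNi.1 hsi.1
    have huw3 : u * w ≤ w / 3 := by nlinarith
    have huw' : u * w ≤ 1 / 9 := by linarith
    have hvuw : v * u * w ≤ u * w / 4 := by
      rw [mul_assoc]
      nlinarith
    have hvuw0 : 0 < v * u * w := by rw [mul_assoc]; exact mul_pos hni.1 huw
    have hle := hsum (R.erase x) (Finset.erase_subset _ _)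
    rcases (R.erase x).eq_empty_or_nonempty with h0 | ⟨y, hy⟩
    · rw [h0, Finset.sum_empty] at H
      rcases he x hx with hex | hex <;> rw [hex] at H <;> push_cast at H <;> linarith
    have hpos : (1 : ℚ) ≤ (R.erase x).card := by
      exact_mod_cast Finset.card_pos.2 ⟨y, hy⟩
    have hex : e x = 2 := (he x hx).resolve_left fun h => by
      rw [h] at H
      push_cast at H
      linarith
    rw [hex] at H
    push_cast at H
    have hcard : (R.erase x).card = 1 := by
      have : 0 < (R.erase x).card := Finset.card_pos.2 ⟨y, hy⟩
      have h2 : (R.erase x).card < 2 := by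
        by_contra hc
        have h2 : (2 : ℚ) ≤ (R.erase x).card := by exact_mod_cast not_lt.1 hc
        linarith
      omega
    obtain ⟨z, hz⟩ := Finset.card_eq_one.1 hcard
    have hzR : z ∈ R := Finset.mem_of_mem_erase (by rw [hz]; simp : z ∈ R.erase x)
    rw [hz, Finset.sum_singleton] at H
    have hzb := term_bounds (ht z hzR) (he z hzR)
    have hez : e z = 2 := (he z hzR).resolve_left fun h => by
      have := hzb.2 h
      linarith
    rw [hez] at H
    push_cast at H
    have htz := ht z hzR
    have htz0 : (0 : ℚ) < t z := by
      have : (2 : ℚ) ≤ t z := by exact_mod_cast htz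
      linarith
    have E : (n : ℚ) * N * t z + 2 * t z = n * (N * s) + 2 * n * t z := by
      have : 1 / (t z : ℚ) * t z = 1 := by field_simp
      have E1 : 1 / (t z : ℚ) = w - 2 * (u * w) + 2 * (v * u * w) := by linarith
      have hn0 : (n : ℚ) ≠ 0 := by linarith
      rw [hw, hu, hv] at E1
      field_simp at E1
      linarith
    have E' : n * N * t z + 2 * t z = n * (N * s) + 2 * n * t z := by exact_mod_cast E
    exact arith_aux hN hNodd hs hsN hn E' htz
end ClassEquation

/-! ### The class equation for subgroups of `SL(2, F)`, and the case without parabolic elements. -/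

namespace SpecialLinearTwo

open Matrix MatrixGroups CommuteTransitive

variable {F : Type*} [Field F] (H : Subgroup SL(2, F))

theorem commuteTransitive : CommuteTransitive (fun x : H => Scalar x.1) where
  conj_iff g x := Scalar.conj_iff g.1
  trans {x y z} hy hxy hyz := by
    have := commute_trans hy (hxy.map H.subtype) (hyz.map H.subtype)
    exact Subtype.ext this

variable {H}

theorem neg_one_ne_one (h2 : (2 : F) ≠ 0) : (-1 : SL(2, F)) ≠ 1 := by
  intro h
  have := congrArg (fun x : SL(2, F) => x 0 0) h
  simp only [neg_ij, one_00] at this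
  exact h2 (by linear_combination -this)

theorem ncard_scalar (h2 : (2 : F) ≠ 0) (hH : -1 ∈ H) : {x : H | Scalar x.1}.ncard = 2 := by
  have : {x : H | Scalar x.1} = {1, ⟨-1, hH⟩} := by
    ext x
    exact or_congr (Subtype.ext_iff (a1 := x) (a2 := 1)).symm
      (Subtype.ext_iff (a1 := x) (a2 := ⟨-1, hH⟩)).symm
  rw [this, Set.ncard_pair]
  intro h
  exact neg_one_ne_one h2 (congrArg Subtype.val h).symm

theorem ncard_not_scalar [Finite F] (h2 : (2 : F) ≠ 0) (hH : -1 ∈ H) :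
    {x : H | ¬ Scalar x.1}.ncard + 2 = Nat.card H := by
  have := Set.ncard_add_ncard_compl {x : H | Scalar x.1}
  rw [ncard_scalar h2 hH] at this
  rw [← this, add_comm]
  rfl

theorem ncard_commute (x : H) :
    {c | Commute c x}.ncard = Nat.card (H ⊓ Subgroup.centralizer {x.1} : Subgroup SL(2, F)) := by
  rw [← Set.ncard_image_of_injective _ (Subtype.val_injective (p := (· ∈ H))),
    ← Nat.card_coe_set_eq]
  refine Nat.card_congr (Equiv.setCongr ?_)
  ext y
  simp only [Set.mem_image, SetLike.mem_coe, Subgroup.mem_inf, Subgroup.mem_centralizer_singleton_iff]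
  constructor
  · rintro ⟨z, hz, rfl⟩
    exact ⟨z.2, congrArg Subtype.val hz.eq⟩
  · rintro ⟨h1, h2⟩
    exact ⟨⟨y, h1⟩, Subtype.ext h2, rfl⟩

theorem ncard_commute_not_scalar [Finite F] (h2 : (2 : F) ≠ 0) (hH : -1 ∈ H) (x : H) :
    {c : H | Commute c x ∧ ¬ Scalar c.1}.ncard + 2 =
      Nat.card (H ⊓ Subgroup.centralizer {x.1} : Subgroup SL(2, F)) := by
  suffices h : {c : H | Commute c x ∧ ¬ Scalar c.1}.ncard + {c : H | Scalar c.1}.ncard =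
      {c : H | Commute c x}.ncard by
    rwa [ncard_scalar h2 hH, ncard_commute] at h
  rw [← Set.ncard_union_eq]
  · congr 1
    ext c
    simp only [Set.mem_union, Set.mem_ofPred_eq]
    constructor
    · rintro (h | h)
      · exact h.1
      · exact Subtype.ext (h.commute x.1)
    · intro h
      by_cases hc : Scalar c.1
      · exact Or.inr hc
      · exact Or.inl ⟨h, hc⟩
  · rw [Set.disjoint_left]
    rintro c ⟨-, h⟩ h'
    exact h h'

theorem even_card [Finite F] (h2 : (2 : F) ≠ 0) (hH : -1 ∈ H) : 2 ∣ Nat.card H := by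
  have : orderOf (⟨-1, hH⟩ : H) = 2 := by
    apply orderOf_eq_prime
    · ext1; simp
    · intro h
      exact neg_one_ne_one h2 (congrArg Subtype.val h)
  have h := orderOf_dvd_natCard (⟨-1, hH⟩ : H)
  rwa [this] at h

theorem neg_one_mem_inf_centralizer (hH : -1 ∈ H) (x : SL(2, F)) :
    -1 ∈ H ⊓ Subgroup.centralizer {x} :=
  ⟨hH, Subgroup.mem_centralizer_singleton_iff.2 (by simp)⟩

theorem four_le_card_centralizer [Finite F] (h2 : (2 : F) ≠ 0) (hH : -1 ∈ H) {x : H}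
    (hx : ¬ Scalar x.1) :
    4 ≤ Nat.card (H ⊓ Subgroup.centralizer {x.1} : Subgroup SL(2, F)) := by
  have h1 := ncard_commute_not_scalar h2 hH x
  have h3 := even_card h2 (neg_one_mem_inf_centralizer hH x.1)
  have : 0 < {c : H | Commute c x ∧ ¬ Scalar c.1}.ncard :=
    (Set.ncard_pos (Set.toFinite _)).2 ⟨x, Commute.refl x, hx⟩
  omega

/-- A semisimple element is conjugate to at most one other element of its centralizer. -/
theorem ncard_normSet [Finite F] (h2 : (2 : F) ≠ 0) {x : H}
    (hx : ¬ Scalar x.1) (ht : tr x.1 ^ 2 ≠ 4) :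
    ∃ e : ℕ, (e = 1 ∨ e = 2) ∧ (normSet x).ncard =
      e * Nat.card (H ⊓ Subgroup.centralizer {x.1} : Subgroup SL(2, F)) := by
  rw [← ncard_commute]
  have key : ∀ n ∈ normSet x, Commute n x ∨ n * x * n⁻¹ = x⁻¹ := by
    intro n hn
    have hn : Commute (n.1 * x.1 * n.1⁻¹) x.1 := Commute.map hn H.subtype
    rcases eq_or_eq_inv_of_commute h2 hx ht hn.symm (tr_conj n.1 x.1) with h | h
    · exact Or.inl (Subtype.ext (commute_of_conj_eq h).symm)
    · exact Or.inr (Subtype.ext h)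
  have hsub : {c | Commute c x} ⊆ normSet x := by
    intro c hc
    have : c * x * c⁻¹ = x := by rw [mul_inv_eq_iff_eq_mul]; exact hc
    rw [normSet, Set.mem_ofPred_eq, this]
    exact Commute.refl x
  by_cases hex : ∃ n ∈ normSet x, n * x * n⁻¹ = x⁻¹ ∧ ¬ Commute n x
  · obtain ⟨n, hn, hinv, hnc⟩ := hex
    refine ⟨2, Or.inr rfl, ?_⟩
    -- The elements inverting `x` form a single coset of its centralizer.
    have hdec : normSet x = {c | Commute c x} ∪ (n * ·) '' {c | Commute c x} := by
      ext m
      constructor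
      · intro hm
        by_cases hmc : Commute m x
        · exact Or.inl hmc
        · right
          have hm' := (key m hm).resolve_left hmc
          refine ⟨n⁻¹ * m, ?_, by simp⟩
          have h1 : n.1 * x.1 * n.1⁻¹ = x.1⁻¹ := congrArg Subtype.val hinv
          have h3 : m.1 * x.1 * m.1⁻¹ = x.1⁻¹ := congrArg Subtype.val hm'
          exact Subtype.ext (commute_of_inverting h1 h3).symm
      · rintro (h | ⟨c, hc, rfl⟩)
        · exact hsub h
        · have hc' : c * x * c⁻¹ = x := by rw [mul_inv_eq_iff_eq_mul]; exact hc
          have : n * c * x * (n * c)⁻¹ = x⁻¹ := by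
            rw [← hinv]; nth_rw 2 [← hc']; group
          rw [normSet, Set.mem_ofPred_eq, this]
          exact (Commute.refl x).inv_left
    rw [hdec, Set.ncard_union_eq, Set.ncard_image_of_injective _ (mul_right_injective n), two_mul]
    rw [Set.disjoint_left]
    rintro m hm ⟨c, hc, rfl⟩
    apply hnc
    have := (show Commute (n * c) x from hm).mul_left (show Commute c x from hc).inv_left
    simpa using this
  · refine ⟨1, Or.inl rfl, ?_⟩
    rw [one_mul]
    congr 1
    refine Set.Subset.antisymm (fun n hn => ?_) hsub
    by_contra hnc
    exact hex ⟨n, hn, (key n hn).resolve_left hnc, hnc⟩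

/-- The density of the fusion class of a semisimple element. -/
theorem exists_fusion_density [Finite F] (h2 : (2 : F) ≠ 0) (hH : -1 ∈ H) {x : H}
    (hx : ¬ Scalar x.1) (ht : tr x.1 ^ 2 ≠ 4) :
    ∃ t e : ℕ, Nat.card (H ⊓ Subgroup.centralizer {x.1} : Subgroup SL(2, F)) = 2 * t ∧ 2 ≤ t ∧
      (e = 1 ∨ e = 2) ∧
      ((fusion (fun x : H => Scalar x.1) x).ncard : ℚ) =
        Nat.card H * ((1 - 1 / (t : ℚ)) / e) := by
  obtain ⟨t, ht2⟩ := even_card h2 (neg_one_mem_inf_centralizer hH x.1)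
  obtain ⟨e, he, hN⟩ := ncard_normSet h2 hx ht
  have h4 := four_le_card_centralizer h2 hH hx
  have h1 := ncard_commute_not_scalar h2 hH x
  have hM := (commuteTransitive H).card_fusion_mul_card_normSet hx
  refine ⟨t, e, ht2, by omega, he, ?_⟩
  rw [hN, ht2] at hM
  rw [ht2] at h1
  have hM' : ((fusion (fun x : H => Scalar x.1) x).ncard : ℚ) * (e * (2 * t)) =
      Nat.card H * {c : H | Commute c x ∧ ¬ Scalar c.1}.ncard := by exact_mod_cast hM
  have h1' : ({c : H | Commute c x ∧ ¬ Scalar c.1}.ncard : ℚ) = 2 * t - 2 := by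
    have : ({c : H | Commute c x ∧ ¬ Scalar c.1}.ncard : ℚ) + 2 = 2 * t := by exact_mod_cast h1
    linarith
  rw [h1'] at hM'
  have ht0 : (t : ℚ) ≠ 0 := by
    have : t ≠ 0 := by omega
    exact_mod_cast this
  have he0 : (e : ℚ) ≠ 0 := by
    rcases he with rfl | rfl <;> norm_num
  field_simp
  linarith

/-- A subgroup without parabolic elements has a large torus. -/
theorem exists_large_centralizer [Finite F] (h2 : (2 : F) ≠ 0) (hH : -1 ∈ H)
    (hpar : ∀ x ∈ H, ¬ Parabolic x) (hne : ∃ x ∈ H, ¬ Scalar x) :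
    ∃ x : H, ¬ Scalar x.1 ∧
      Nat.card H < 2 * Nat.card (H ⊓ Subgroup.centralizer {x.1} : Subgroup SL(2, F)) ^ 2 := by
  classical
  obtain ⟨R, -, hR, -, hsum⟩ := (commuteTransitive H).exists_representatives ∅ (by simp) (by simp)
  have hss : ∀ x : R, tr x.1.1 ^ 2 ≠ 4 := fun x h => hpar x.1.1 x.1.2 ⟨hR x.1 x.2, h⟩
  choose t e h1 h2' h3 h4 using fun x : R => exists_fusion_density h2 hH (hR x.1 x.2) (hss x)
  have hcard := ncard_not_scalar h2 hH
  obtain ⟨x0, hx0, hx0'⟩ := hne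
  have hpos : 0 < {x : H | ¬ Scalar x.1}.ncard :=
    (Set.ncard_pos (Set.toFinite _)).2 ⟨⟨x0, hx0⟩, hx0'⟩
  obtain ⟨h, hh⟩ := even_card h2 hH
  have hh2 : 2 ≤ h := by omega
  -- The classes fill the `|H| - 2` noncentral elements; divide by `|H| = 2 h`.
  have hq : ∑ x ∈ R.attach, (1 - 1 / (t x : ℚ)) / e x = 1 - 1 / h := by
    have hsum' : ∑ x ∈ R.attach, ((fusion (fun x : H => Scalar x.1) x.1).ncard : ℚ) =
        Nat.card H - 2 := by
      rw [← hcard, ← hsum]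
      push_cast
      rw [Finset.sum_attach R fun x => ((fusion (fun x : H => Scalar x.1) x).ncard : ℚ)]
      ring
    simp only [h4] at hsum'
    rw [← Finset.mul_sum, hh] at hsum'
    have : (h : ℚ) ≠ 0 := by
      have : h ≠ 0 := by omega
      exact_mod_cast this
    push_cast at hsum'
    rw [eq_sub_iff_add_eq]
    apply mul_left_cancel₀ this
    field_simp at hsum' ⊢
    linarith
  obtain ⟨x, -, hx⟩ := ClassEquation.exists_large_torus R.attach t e hh2 (fun x _ => h2' x)
    (fun x _ => h3 x) hq
  refine ⟨x.1, hR x.1 x.2, ?_⟩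
  rw [h1, hh]
  nlinarith

theorem card_mul_relIndex {G : Type*} [Group G] {K L : Subgroup G} (hKL : K ≤ L) :
    Nat.card K * K.relIndex L = Nat.card L := by
  simpa using Subgroup.relIndex_mul_relIndex ⊥ K L bot_le hKL

/-- A subgroup strictly between `K` and `L` would make the index at least `4`, so any `z` in `L`
outside `K` works. -/
theorem exists_sup_zpowers_eq_of_relIndex_le {G : Type*} [Group G] [Finite G] {K L : Subgroup G}
    (hKL : K ≤ L) (h : K.relIndex L ≤ 3) : ∃ z, K ⊔ Subgroup.zpowers z = L := by
  by_cases hle : L ≤ K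
  · exact ⟨1, by simp [le_antisymm hKL hle]⟩
  · obtain ⟨z, hz, hzK⟩ := SetLike.not_le_iff_exists.1 hle
    refine ⟨z, ?_⟩
    have h1 : K ⊔ Subgroup.zpowers z ≤ L := sup_le hKL (by simpa using hz)
    refine le_antisymm h1 ?_
    rw [← Subgroup.relIndex_eq_one]
    have h2 := Subgroup.relIndex_mul_relIndex K (K ⊔ Subgroup.zpowers z) L le_sup_left h1
    have h3 : K.relIndex (K ⊔ Subgroup.zpowers z) ≠ 1 := by
      rw [Ne, Subgroup.relIndex_eq_one]
      intro h
      exact hzK (h (Subgroup.mem_sup_right (Subgroup.mem_zpowers z)))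
    have h4 : K.relIndex L ≠ 0 := Subgroup.index_ne_zero_of_finite
    rw [← h2] at h h4
    have h5 := (mul_ne_zero_iff.1 h4)
    have : 2 ≤ K.relIndex (K ⊔ Subgroup.zpowers z) := by omega
    have : 1 ≤ (K ⊔ Subgroup.zpowers z).relIndex L := by omega
    nlinarith

/-- A subgroup without parabolic elements is generated by `-1` and three elements. -/
theorem exists_generators_of_not_parabolic [Finite F] (h2 : (2 : F) ≠ 0) (hH : -1 ∈ H)
    (hpar : ∀ x ∈ H, ¬ Parabolic x) :
    ∃ a b c, Subgroup.closure {-1, a, b, c} = H := by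
  by_cases hne : ∃ x ∈ H, ¬ Scalar x
  swap
  · push Not at hne
    refine ⟨1, 1, 1, le_antisymm ?_ fun x hx => ?_⟩
    · rw [Subgroup.closure_le]
      rintro x (rfl | rfl | rfl | rfl)
      exacts [hH, H.one_mem, H.one_mem, H.one_mem]
    · rcases hne x hx with rfl | rfl
      · exact Subgroup.one_mem _
      · exact Subgroup.subset_closure (by simp)
  obtain ⟨x, hx, hlt⟩ := exists_large_centralizer h2 hH hpar hne
  have ht : tr x.1 ^ 2 ≠ 4 := fun h => hpar x.1 x.2 ⟨hx, h⟩
  set C : Subgroup SL(2, F) := H ⊓ Subgroup.centralizer {x.1} with hC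
  have hcyc : IsCyclic C := by
    have := isCyclic_centralizer hx ht
    exact Subgroup.isCyclic_of_le (inf_le_right : C ≤ Subgroup.centralizer {x.1})
  obtain ⟨c, hc⟩ := Subgroup.isCyclic_iff_exists_zpowers_eq_top C |>.1 hcyc
  have hCH : C ≤ H := inf_le_left
  suffices hK : ∃ K y, K = C ⊔ Subgroup.zpowers y ∧ K ≤ H ∧ K.relIndex H ≤ 3 by
    obtain ⟨K, y, hK, hKH, hidx⟩ := hK
    obtain ⟨z, hz⟩ := exists_sup_zpowers_eq_of_relIndex_le hKH hidx
    refine ⟨c, y, z, ?_⟩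
    have hle : Subgroup.zpowers (-1 : SL(2, F)) ≤ C :=
      Subgroup.zpowers_le.2 (neg_one_mem_inf_centralizer hH x.1)
    rw [← hz, hK, ← hc]
    rw [← hc] at hle
    simp only [Set.insert_eq, Subgroup.closure_union, ← Subgroup.zpowers_eq_closure]
    rw [← sup_assoc, ← sup_assoc, sup_eq_right.2 hle]
  have hmul := card_mul_relIndex hCH
  by_cases hex : ∃ y : H, y ∉ normSet x
  · obtain ⟨y, hy⟩ := hex
    set K := C ⊔ Subgroup.zpowers y.1 with hKdef
    have hKH : K ≤ H := sup_le hCH (by simp)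
    refine ⟨K, y.1, rfl, hKH, ?_⟩
    have hCK : C ≤ K := le_sup_left
    have hyK : y.1 ∈ K := Subgroup.mem_sup_right (Subgroup.mem_zpowers _)
    let C' := C.map (MulAut.conj y.1).toMonoidHom
    have hC'K : C' ≤ K := by
      rintro _ ⟨z, hz, rfl⟩
      exact K.mul_mem (K.mul_mem hyK (hCK hz)) (K.inv_mem hyK)
    have hcard' : Nat.card C' = Nat.card C :=
      Nat.card_congr (C.equivMapOfInjective _ (MulAut.conj y.1).injective).symm.toEquiv
    -- A noncentral element of the intersection commutes with `x` and with its conjugate by `y`, so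
    -- by transitivity these two commute, against the choice of `y`.
    have hint : Nat.card (C ⊓ C' : Subgroup SL(2, F)) ≤ 2 := by
      have hs : ((C ⊓ C' : Subgroup SL(2, F)) : Set SL(2, F)) ⊆ {1, -1} := by
        rintro z ⟨hz1, w, hw, rfl⟩
        by_contra hns
        have hns : ¬ Scalar ((MulAut.conj y.1).toMonoidHom w) := hns
        apply hy
        have e1 : Commute ((MulAut.conj y.1).toMonoidHom w) x.1 :=
          Subgroup.mem_centralizer_singleton_iff.1 hz1.2
        have e2 : Commute w x.1 := Subgroup.mem_centralizer_singleton_iff.1 hw.2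
        have e3 := (e2.conj_conj y.1).symm
        exact Subtype.ext (commute_trans hns e3 e1)
      have := Set.ncard_le_ncard hs (Set.toFinite _)
      rw [← Nat.card_coe_set_eq] at this
      exact this.trans (Set.ncard_insert_le _ _ |>.trans (by simp))
    have e1 := card_mul_relIndex (inf_le_right : C ⊓ C' ≤ C')
    rw [Subgroup.inf_relIndex_right, hcard'] at e1
    have e2 : C.relIndex C' ≤ C.relIndex K :=
      Subgroup.relIndex_le_of_le_right hC'K Subgroup.index_ne_zero_of_finite
    have e3 := Subgroup.relIndex_mul_relIndex C K H hCK hKH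
    rw [← e3] at hmul
    have hCpos : 0 < Nat.card C := Nat.card_pos
    by_contra hcon
    -- `C'` meets `C` in at most two elements, so `C` has index at least `|C| / 2` in `K`. Index of
    -- `K` in `H` at least `4` would then contradict `|H| < 2|C|²`.
    have e4 : Nat.card C ≤ 2 * C.relIndex K := by nlinarith
    have e5 : Nat.card C * Nat.card C * 4 ≤ 2 * (Nat.card C * (C.relIndex K * K.relIndex H)) := by
      calc Nat.card C * Nat.card C * 4 ≤ Nat.card C * (2 * C.relIndex K) * K.relIndex H := by
            gcongr; omega
        _ = _ := by ring
    nlinarith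
  · push Not at hex
    refine ⟨C, 1, by simp, hCH, ?_⟩
    obtain ⟨e, he, hN⟩ := ncard_normSet h2 hx ht
    have : normSet x = Set.univ := Set.eq_univ_of_forall hex
    rw [this, Set.ncard_univ, ← hmul, mul_comm] at hN
    have := Nat.eq_of_mul_eq_mul_right Nat.card_pos hN
    omega

end SpecialLinearTwo

/-! ### Unitriangular matrices, Hua's identity and `SL₂` over a subfield. -/

namespace SpecialLinearTwo

open Matrix MatrixGroups

variable {F : Type*} [Field F]

/-- Upper unitriangular matrices. -/
def unip (a : F) : SL(2, F) := mk 1 a 0 1 (by ring)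

@[simp] theorem unip_00 (a : F) : unip a 0 0 = 1 := rfl
@[simp] theorem unip_01 (a : F) : unip a 0 1 = a := rfl
@[simp] theorem unip_10 (a : F) : unip a 1 0 = 0 := rfl
@[simp] theorem unip_11 (a : F) : unip a 1 1 = 1 := rfl

theorem unip_add (a b : F) : unip (a + b) = unip a * unip b := by
  apply ext_entries <;> simp only [mul_00, mul_01, mul_10, mul_11, unip_00, unip_01, unip_10,
    unip_11] <;> ring

theorem unip_zero : unip (0 : F) = 1 := by
  apply ext_entries <;> simp

theorem unip_neg (a : F) : unip (-a) = (unip a)⁻¹ := by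
  apply ext_entries <;> simp only [inv_00, inv_01, inv_10, inv_11, unip_00, unip_01, unip_10,
    unip_11, neg_zero]

/-- Diagonal matrices. -/
def diag : Fˣ →* SL(2, F) where
  toFun d := mk d 0 0 (d⁻¹ : Fˣ) (by simp)
  map_one' := by apply ext_entries <;> simp
  map_mul' d e := by
    apply ext_entries <;> simp only [mul_00, mul_01, mul_10, mul_11, mk_00, mk_01, mk_10,
      mk_11, Units.val_mul, mul_inv] <;> ring

@[simp] theorem diag_00 (d : Fˣ) : diag d 0 0 = d := rfl
@[simp] theorem diag_01 (d : Fˣ) : diag d 0 1 = 0 := rfl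
@[simp] theorem diag_10 (d : Fˣ) : diag d 1 0 = 0 := rfl
@[simp] theorem diag_11 (d : Fˣ) : diag d 1 1 = (d : F)⁻¹ := by
  rw [← Units.val_inv_eq_inv_val]; rfl

/-- The Weyl element. -/
def weyl : SL(2, F) := mk 0 1 (-1) 0 (by ring)

@[simp] theorem weyl_00 : (weyl : SL(2, F)) 0 0 = 0 := rfl
@[simp] theorem weyl_01 : (weyl : SL(2, F)) 0 1 = 1 := rfl
@[simp] theorem weyl_10 : (weyl : SL(2, F)) 1 0 = -1 := rfl
@[simp] theorem weyl_11 : (weyl : SL(2, F)) 1 1 = 0 := rfl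

/-- The elements `a` such that the upper unitriangular matrix with entry `a` lies in `H`. -/
def unipSet (H : Subgroup SL(2, F)) : AddSubgroup F where
  carrier := {a | unip a ∈ H}
  zero_mem' := by simp [unip_zero, H.one_mem]
  add_mem' {a b} ha hb := by
    rw [Set.mem_ofPred_eq, unip_add]
    exact H.mul_mem ha hb
  neg_mem' {a} ha := by
    rw [Set.mem_ofPred_eq, unip_neg]
    exact H.inv_mem ha

theorem mem_unipSet {H : Subgroup SL(2, F)} {a : F} : a ∈ unipSet H ↔ unip a ∈ H := Iff.rfl

theorem half_mem [Finite F] (h2 : (2 : F) ≠ 0) (A : AddSubgroup F) {x : F} (hx : 2 * x ∈ A) :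
    x ∈ A := by
  have := Fintype.ofFinite F
  obtain ⟨p, hp⟩ := CharP.exists F
  have hp' : p.Prime := CharP.char_is_prime F p
  have hodd : Odd p := hp'.odd_of_ne_two fun h => h2 (by
    have := CharP.cast_eq_zero F p
    rw [h] at this
    exact_mod_cast this)
  obtain ⟨k, hk⟩ := hodd
  have hz : (2 * k + 1 : F) = 0 := by
    have := CharP.cast_eq_zero F p
    rw [hk] at this
    exact_mod_cast this
  -- The multiple `k + 1 = (p + 1) / 2` acts as division by `2`.
  have : (k + 1) • (2 * x) = x := by
    rw [nsmul_eq_mul]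
    push_cast
    linear_combination x * hz
  rw [← this]
  exact A.nsmul_mem hx _

/-- Hua's identity: an additive subgroup containing `1` and closed under `a ↦ σ / a` is a
subfield. -/
theorem exists_subfield_of_inv_closed [Finite F] (h2 : (2 : F) ≠ 0) (A : AddSubgroup F)
    (h1 : 1 ∈ A) {σ : F} (hσ : σ ≠ 0) (hA : ∀ a ∈ A, a ≠ 0 → σ * a⁻¹ ∈ A) :
    ∃ k : Subfield F, (∀ x, x ∈ k ↔ x ∈ A) ∧ σ ∈ k := by
  have hσA : σ ∈ A := by simpa using hA 1 h1 one_ne_zero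
  have hB : ∀ b, σ * b ∈ A → b ≠ 0 → b⁻¹ ∈ A := by
    intro b hb hb0
    have := hA _ hb (mul_ne_zero hσ hb0)
    rwa [mul_inv, mul_inv_cancel_left₀ hσ] at this
  -- Hua's identity is `((b⁻¹ - a)⁻¹ + a⁻¹)⁻¹ = a - a² b`. The condition `σ * b ∈ A` is what makes
  -- inverses of nonzero `b` land in `A`, so the twist by `σ` cancels over two inversions.
  have hua : ∀ a ∈ A, ∀ b, σ * b ∈ A → a ^ 2 * b ∈ A := by
    intro a ha b hb
    by_cases ha0 : a = 0
    · simp [ha0, A.zero_mem]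
    by_cases hb0 : b = 0
    · simp [hb0, A.zero_mem]
    by_cases hab : a * b = 1
    · rw [show a ^ 2 * b = a by linear_combination a * hab]; exact ha
    have hne : b⁻¹ - a ≠ 0 := by
      intro h
      apply hab
      field_simp at h
      linear_combination -h
    have hne' : 1 - a * b ≠ 0 := fun h => hab (by linear_combination -h)
    have e1 : σ * ((b⁻¹ - a)⁻¹ + a⁻¹) ∈ A := by
      rw [mul_add]
      exact A.add_mem (hA _ (A.sub_mem (hB b hb hb0) ha) hne) (hA a ha ha0)
    have e2 : (b⁻¹ - a)⁻¹ + a⁻¹ = (a - a ^ 2 * b)⁻¹ := by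
      have : a - a ^ 2 * b = a * (1 - a * b) := by ring
      rw [this]
      have : b⁻¹ - a = (1 - a * b) / b := by field_simp
      rw [this]
      field_simp
      ring
    have hne2 : a - a ^ 2 * b ≠ 0 := by
      have : a - a ^ 2 * b = a * (1 - a * b) := by ring
      rw [this]
      exact mul_ne_zero ha0 hne'
    rw [e2] at e1
    have e3 := hB _ e1 (inv_ne_zero hne2)
    rw [inv_inv] at e3
    have := A.sub_mem ha e3
    simpa using this
  -- Polarize `a² b` and halve. Then `b = 1` gives products, since `σ ∈ A`, and `b = a⁻¹` gives
  -- inverses.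
  have hmul3 : ∀ a ∈ A, ∀ c ∈ A, ∀ b, σ * b ∈ A → a * c * b ∈ A := by
    intro a ha c hc b hb
    apply half_mem h2
    have := A.sub_mem (A.sub_mem (hua _ (A.add_mem ha hc) b hb) (hua a ha b hb)) (hua c hc b hb)
    convert this using 1
    ring
  have hmul : ∀ a ∈ A, ∀ c ∈ A, a * c ∈ A := by
    intro a ha c hc
    simpa using hmul3 a ha c hc 1 (by simpa using hσA)
  have hinv : ∀ a ∈ A, a⁻¹ ∈ A := by
    intro a ha
    by_cases ha0 : a = 0
    · simp [ha0, A.zero_mem]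
    · simpa using hmul3 1 h1 1 h1 a⁻¹ (hA a ha ha0)
  exact ⟨{ carrier := A
           mul_mem' := fun {a b} ha hb => hmul a ha b hb
           one_mem' := h1
           add_mem' := A.add_mem
           zero_mem' := A.zero_mem
           neg_mem' := A.neg_mem
           inv_mem' := hinv }, fun x => Iff.rfl, hσA⟩

/-- The quadratic character of `k` is `-1` at `-1`, so one of `x`, `-x` is a square in `k` for each
nonzero `x`. -/
theorem exists_sq_eq_or_neg [Finite F] (hns : ¬ IsSquare (-1 : F)) (k : Subfield F) {x : F}
    (hx : x ∈ k) : ∃ c ∈ k, x = c ^ 2 ∨ x = -c ^ 2 := by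
  classical
  have := Fintype.ofFinite k
  have hk : ringChar k ≠ 2 := by
    intro h
    apply hns
    have h2 : CharP k 2 := h ▸ ringChar.charP k
    have h3 : CharP F 2 := (k.subtype.charP_iff k.subtype.injective 2).1 h2
    rw [CharTwo.neg_eq]
    exact IsSquare.one
  have hns' : ¬ IsSquare (-1 : k) := by
    rintro ⟨c, hc⟩
    exact hns ⟨c, by simpa using congrArg Subtype.val hc⟩
  let y : k := ⟨x, hx⟩
  by_cases hy : IsSquare y
  · obtain ⟨c, hc⟩ := hy
    exact ⟨c, c.2, Or.inl (by rw [sq]; exact congrArg Subtype.val hc)⟩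
  · have h1 := quadraticChar_neg_one_iff_not_isSquare.2 hy
    have h3 := quadraticChar_neg_one_iff_not_isSquare.2 hns'
    have h4 : quadraticChar k (-y) = 1 := by
      rw [neg_eq_neg_one_mul, map_mul, h1, h3]; rfl
    have hy0 : -y ≠ 0 := by
      intro h
      rw [h] at h4
      simp at h4
    obtain ⟨c, hc⟩ := (quadraticChar_one_iff_isSquare hy0).1 h4
    refine ⟨c, c.2, Or.inr ?_⟩
    have := congrArg Subtype.val hc
    simp only [NegMemClass.coe_neg, MulMemClass.coe_mul, y] at this
    rw [sq, ← this, neg_neg]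

theorem mem_of_sq_mem [Finite F] (hns : ¬ IsSquare (-1 : F)) (k : Subfield F) {d : F}
    (hd : d ^ 2 ∈ k) : d ∈ k := by
  obtain ⟨c, hc, h | h⟩ := exists_sq_eq_or_neg hns k hd
  · rcases sq_eq_sq_iff_eq_or_eq_neg.1 h with rfl | rfl
    · exact hc
    · exact k.neg_mem hc
  · by_cases hc0 : c = 0
    · rw [hc0] at h
      have : d = 0 := by simpa using h
      rw [this]; exact k.zero_mem
    · exact absurd ⟨d / c, by field_simp; linear_combination -h⟩ hns

/-- If the points moved to infinity by `H` are only those given by unitriangular elements, then `H`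
is `SL₂` over a subfield, and is generated by three elements. -/
theorem exists_generators_of_doubly_transitive [Finite F] (h2 : (2 : F) ≠ 0)
    (hns : ¬ IsSquare (-1 : F)) {H : Subgroup SL(2, F)} (h1 : 1 ∈ unipSet H) (hH : -1 ∈ H)
    {g : SL(2, F)} (hg : g ∈ H) (hg0 : g 0 0 = 0)
    (htr : ∀ y ∈ H, y 1 0 ≠ 0 → ∃ a ∈ unipSet H, y 0 0 = a * y 1 0) :
    ∃ a b c, Subgroup.closure {-1, a, b, c} = H := by
  have hs : ∀ g : SL(2, F), g 0 0 = 0 → g 1 0 ≠ 0 := by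
    intro g hg h
    have := det_entries g
    simp [hg, h] at this
  -- Conjugating upper unitriangular matrices by an element that moves infinity to `0` gives lower
  -- unitriangular ones. They move infinity to points `-1 / (g₁₀² a)`, which `htr` puts in the
  -- unipotent group.
  have hlow : ∀ g ∈ H, ∀ hg : g 0 0 = 0, ∀ a ∈ unipSet H,
      mk 1 0 (-(g 1 0 ^ 2 * a)) 1 (by ring) ∈ H := by
    intro g hgH hg a ha
    convert H.mul_mem (H.mul_mem hgH ha) (H.inv_mem hgH) using 1
    have hd := det_entries g
    rw [hg] at hd
    apply ext_entries <;> simp only [mul_00, mul_01, mul_10, mul_11, inv_00, inv_01, inv_10,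
      inv_11, unip_00, unip_01, unip_10, unip_11, mk_00, mk_01, mk_10, mk_11, hg]
    · linear_combination -hd
    · ring
    · ring
    · linear_combination -hd
  have hclosed : ∀ g ∈ H, g 0 0 = 0 → ∀ a ∈ unipSet H, a ≠ 0 →
      (g 1 0 ^ 2)⁻¹ * a⁻¹ ∈ unipSet H := by
    intro g hgH hg a ha ha0
    have hs0 := hs g hg
    obtain ⟨b, hb, e⟩ := htr _ (hlow g hgH hg a ha) (by simp [hs0, ha0])
    simp only [mk_00, mk_10] at e
    have : (g 1 0 ^ 2)⁻¹ * a⁻¹ = -b := by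
      field_simp
      linear_combination e
    rw [this]
    exact (unipSet H).neg_mem hb
  obtain ⟨k, hk, -⟩ := exists_subfield_of_inv_closed h2 (unipSet H) h1
    (inv_ne_zero (pow_ne_zero 2 (hs g hg0))) (hclosed g hg hg0)
  -- A translation by `-a` makes the upper left entry zero without changing the lower left one;
  -- `hclosed` at `1` then puts the square of that entry in `k`, and `mem_of_sq_mem` the entry
  -- itself.
  have hk10 : ∀ y ∈ H, y 1 0 ≠ 0 → y 1 0 ∈ k ∧ y 0 0 ∈ k := by
    intro y hy h0
    obtain ⟨a, ha, e⟩ := htr y hy h0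
    have hz : (unip (-a) * y) ∈ H := H.mul_mem ((unipSet H).neg_mem ha) hy
    have hz0 : (unip (-a) * y) 0 0 = 0 := by
      rw [mul_00, unip_00, unip_01, e]; ring
    have hz1 : (unip (-a) * y) 1 0 = y 1 0 := by
      rw [mul_10, unip_10, unip_11]; ring
    have := hclosed _ hz hz0 1 h1 one_ne_zero
    rw [hz1, inv_one, mul_one, ← hk] at this
    have := mem_of_sq_mem hns k (by simpa using k.inv_mem this : y 1 0 ^ 2 ∈ k)
    exact ⟨this, by rw [e]; exact k.mul_mem ((hk a).2 ha) this⟩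
  have hent : ∀ y ∈ H, y 1 0 ≠ 0 → y 0 0 ∈ k ∧ y 0 1 ∈ k ∧ y 1 0 ∈ k ∧ y 1 1 ∈ k := by
    intro y hy h0
    obtain ⟨e1, e2⟩ := hk10 y hy h0
    have e3 := (hk10 y⁻¹ (H.inv_mem hy) (by rw [inv_10]; exact neg_ne_zero.2 h0)).2
    rw [inv_00] at e3
    refine ⟨e2, ?_, e1, e3⟩
    have hd := det_entries y
    have : y 0 1 = (y 0 0 * y 1 1 - 1) * (y 1 0)⁻¹ := by
      field_simp
      linear_combination -hd
    rw [this]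
    exact k.mul_mem (k.sub_mem (k.mul_mem e2 e3) k.one_mem) (k.inv_mem e1)
  have hent' : ∀ y ∈ H, y 0 0 ∈ k ∧ y 0 1 ∈ k ∧ y 1 0 ∈ k := by
    intro y hy
    by_cases h0 : y 1 0 = 0
    · have hd := det_entries y
      rw [h0] at hd
      have hy0 : y 0 0 ≠ 0 := by
        intro h
        rw [h] at hd
        simp at hd
      -- Upper triangular elements are reached through `y = g⁻¹ (g y)`, where `g` and `g y` both
      -- have nonzero lower left entry.
      have hgy : (g * y) 1 0 ≠ 0 := by
        rw [mul_10, h0, mul_zero, add_zero]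
        exact mul_ne_zero (hs g hg0) hy0
      obtain ⟨a1, a2, a3, a4⟩ := hent (g * y) (H.mul_mem hg hy) hgy
      obtain ⟨b1, b2, b3, b4⟩ := hent g hg (hs g hg0)
      have e : y = g⁻¹ * (g * y) := by group
      refine ⟨?_, ?_, by rw [h0]; exact k.zero_mem⟩
      · rw [e, mul_00, inv_00, inv_01]
        exact k.add_mem (k.mul_mem b4 a1) (k.mul_mem (k.neg_mem b2) a3)
      · rw [e, mul_01, inv_00, inv_01]
        exact k.add_mem (k.mul_mem b4 a2) (k.mul_mem (k.neg_mem b2) a4)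
    · obtain ⟨a1, a2, a3, a4⟩ := hent y hy h0
      exact ⟨a1, a2, a3⟩
  have hlow' : ∀ b ∈ k, mk 1 0 b 1 (by ring) ∈ H := by
    intro b hb
    have e := (hent' g hg).2.2
    have := hlow g hg hg0 (-(b * (g 1 0 ^ 2)⁻¹))
      ((hk _).1 (k.neg_mem (k.mul_mem hb (k.inv_mem (k.pow_mem e 2)))))
    convert this using 2
    field_simp [hs g hg0]
  have hweyl : weyl ∈ H := by
    have := H.mul_mem (H.mul_mem h1 (hlow' (-1) (k.neg_mem k.one_mem))) h1
    convert this using 1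
    apply ext_entries <;> simp [mul_00, mul_01, mul_10, mul_11]
  have hdiag : ∀ d : Fˣ, (d : F) ∈ k → diag d ∈ H := by
    intro d hd
    have hu : unip (d : F) ∈ H := (hk _).1 hd
    have := H.mul_mem (H.mul_mem (H.mul_mem hu (hlow' (-(d : F)⁻¹) (k.neg_mem (k.inv_mem hd)))) hu)
      (H.inv_mem hweyl)
    convert this using 1
    apply ext_entries <;> simp [mul_00, mul_01, mul_10, mul_11, inv_00, inv_01, inv_10, inv_11]
  obtain ⟨l, hl⟩ := IsCyclic.exists_generator (α := kˣ)
  let lam : Fˣ := Units.map k.subtype.toMonoidHom l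
  have hlam : ∀ d : Fˣ, (d : F) ∈ k → d ∈ Subgroup.zpowers lam := by
    intro d hd
    have hd0 : (⟨d, hd⟩ : k) ≠ 0 := by
      intro h
      exact d.ne_zero (congrArg Subtype.val h)
    obtain ⟨n, hn⟩ := Subgroup.mem_zpowers_iff.1 (hl (Units.mk0 ⟨d, hd⟩ hd0))
    refine ⟨n, ?_⟩
    change Units.map k.subtype.toMonoidHom l ^ n = d
    rw [← map_zpow, hn]
    ext
    rfl
  refine ⟨unip 1, weyl, diag lam, le_antisymm ?_ ?_⟩
  · rw [Subgroup.closure_le]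
    rintro x (rfl | rfl | rfl | rfl)
    exacts [hH, h1, hweyl, hdiag lam l.1.2]
  set G := Subgroup.closure {-1, unip 1, weyl, diag lam}
  have gu : unip 1 ∈ G := Subgroup.subset_closure (by simp)
  have gw : weyl ∈ G := Subgroup.subset_closure (by simp)
  have gd : ∀ d : Fˣ, (d : F) ∈ k → diag d ∈ G := by
    intro d hd
    obtain ⟨n, rfl⟩ := Subgroup.mem_zpowers_iff.1 (hlam d hd)
    rw [map_zpow]
    exact G.zpow_mem (Subgroup.subset_closure (by simp)) n
  -- Conjugation by `diag d` multiplies the unitriangular entry by `d²`; the other entries are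
  -- negatives of squares.
  have gsq : ∀ d ∈ k, unip (d ^ 2) ∈ G := by
    intro d hd
    by_cases hd0 : d = 0
    · rw [hd0, zero_pow two_ne_zero, unip_zero]; exact G.one_mem
    have hD := gd (Units.mk0 d hd0) hd
    convert G.mul_mem (G.mul_mem hD gu) (G.inv_mem hD) using 1
    apply ext_entries <;> simp [mul_00, mul_01, mul_10, mul_11, inv_00, inv_01, inv_10, inv_11, hd0]
    ring
  have gall : ∀ a ∈ k, unip a ∈ G := by
    intro a ha
    obtain ⟨c, hc, rfl | rfl⟩ := exists_sq_eq_or_neg hns k ha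
    · exact gsq c hc
    · rw [unip_neg]; exact G.inv_mem (gsq c hc)
  have gupper : ∀ y : SL(2, F), y 0 0 ∈ k → y 0 1 ∈ k → y 1 0 = 0 → y ∈ G := by
    intro y e0 e1 h0
    have hd := det_entries y
    rw [h0, mul_zero, sub_zero] at hd
    have hy0 : y 0 0 ≠ 0 := left_ne_zero_of_mul_eq_one hd
    convert G.mul_mem (gd (Units.mk0 _ hy0) e0) (gall (y 0 1 * (y 0 0)⁻¹)
      (k.mul_mem e1 (k.inv_mem e0))) using 1
    apply ext_entries <;> simp [mul_00, mul_01, mul_10, mul_11, h0]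
    · field_simp
    · exact eq_inv_of_mul_eq_one_right hd
  intro y hy
  obtain ⟨e0, e1, e2⟩ := hent' y hy
  by_cases h0 : y 1 0 = 0
  · exact gupper y e0 e1 h0
  obtain ⟨f0, f1, f2, f3⟩ := hent y hy h0
  obtain ⟨a, ha, e⟩ := htr y hy h0
  -- Bruhat decomposition: a translation and the Weyl element reduce `y` to an upper triangular
  -- matrix.
  have hz : weyl⁻¹ * (unip (-a) * y) ∈ G := by
    apply gupper
    · simp [mul_00, mul_10, inv_00, inv_01, e2]
    · simp [mul_01, mul_11, inv_00, inv_01, f3]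
    · simp [mul_10, mul_00, inv_10, inv_11, e]
  have hua : unip (-a) ∈ G := gall _ (k.neg_mem ((hk a).2 ha))
  rwa [G.mul_mem_cancel_left (G.inv_mem gw), G.mul_mem_cancel_left hua] at hz

end SpecialLinearTwo

/-! ### Fusion of parabolic elements, the Borel subgroup and its torus. -/

namespace SpecialLinearTwo

open Matrix MatrixGroups CommuteTransitive

variable {F : Type*} [Field F] {H : Subgroup SL(2, F)}

theorem not_scalar_unip_one : ¬ Scalar (unip (1 : F)) := by
  rw [not_scalar_iff]
  simp

/-- Cayley–Hamilton gives `(x - 1)² = 0`, and the `p`-th power is additive on the commuting matrices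
`x` and `1`. -/
theorem pow_ringChar_eq_one {p : ℕ} [Fact p.Prime] [CharP F p] {x : SL(2, F)} (ht : tr x = 2) :
    x ^ p = 1 := by
  have hd := det_entries x
  unfold tr at ht
  have hp2 : 2 ≤ p := (Fact.out : p.Prime).two_le
  have hsq : (x.1 - 1) ^ 2 = 0 := by
    rw [sq]
    ext i j
    fin_cases i <;> fin_cases j <;> simp [Matrix.mul_apply, Fin.sum_univ_two]
    · linear_combination -hd + x 0 0 * ht
    · linear_combination x 0 1 * ht
    · linear_combination x 1 0 * ht
    · linear_combination -hd + x 1 1 * ht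
  have h0 : (x.1 - 1) ^ p = 0 := pow_eq_zero_of_le hp2 hsq
  rw [sub_pow_char_of_commute p (Commute.one_right x.1), one_pow, sub_eq_zero] at h0
  exact Subtype.ext (by simpa using h0)

/-- Any two unipotent elements of `H` are fused. -/
theorem mem_fusion_of_trace_two [Finite F] (h2 : (2 : F) ≠ 0) {x y : H} (hx : ¬ Scalar x.1)
    (hy : ¬ Scalar y.1) (htx : tr x.1 = 2) (hty : tr y.1 = 2) :
    y ∈ fusion (fun x : H => Scalar x.1) x := by
  obtain ⟨p, hp⟩ := CharP.exists F
  have hp' : Fact p.Prime := ⟨CharP.char_is_prime F p⟩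
  have hpg : ∀ z : H, tr z.1 = 2 → IsPGroup p (Subgroup.zpowers z) := by
    intro z hz
    have : z ^ p ^ 1 = 1 := by
      rw [pow_one]
      exact Subtype.ext (pow_ringChar_eq_one hz)
    exact IsPGroup.of_card_dvd_pow (n := 1) (by rw [Nat.card_zpowers]; exact orderOf_dvd_of_pow_eq_one this)
  -- By Sylow's theorem a conjugate of `y` lies in the same Sylow subgroup as `x`. Both commute with
  -- a nontrivial central element `z` of it, which is not `-1` because `p` is odd; transitivity
  -- through `z` finishes.
  obtain ⟨P, hP⟩ := (hpg x htx).exists_le_sylow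
  obtain ⟨Q, hQ⟩ := (hpg y hty).exists_le_sylow
  obtain ⟨g, rfl⟩ := MulAction.exists_smul_eq H Q P
  have hxP := hP (Subgroup.mem_zpowers x)
  have hyQ := hQ (Subgroup.mem_zpowers y)
  have hyP : g * y * g⁻¹ ∈ g • Q := by
    rw [← SetLike.mem_coe, Sylow.coe_smul]
    exact Set.smul_mem_smul_set (a := MulAut.conj g) hyQ
  have hnt : Nontrivial (g • Q : Sylow p H) := by
    refine ⟨⟨x, hxP⟩, 1, fun h => hx (Or.inl ?_)⟩
    exact congrArg (fun z : (g • Q : Sylow p H) => z.1.1) h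
  have hcn := (g • Q).isPGroup'.center_nontrivial
  obtain ⟨⟨z, hz⟩, hz1⟩ := exists_ne (1 : Subgroup.center (g • Q : Sylow p H))
  have hzc : ∀ w ∈ g • Q, Commute w z.1 := fun w hw =>
    congrArg Subtype.val (Subgroup.mem_center_iff.1 hz ⟨w, hw⟩)
  have hzs : ¬ Scalar z.1.1 := by
    rintro (h | h)
    · exact hz1 (Subtype.ext (Subtype.ext (Subtype.ext h)))
    · obtain ⟨k, hk⟩ := (g • Q).isPGroup' z
      have hodd : Odd p := hp'.out.odd_of_ne_two fun h => h2 (by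
        have := CharP.cast_eq_zero F p
        rw [h] at this
        exact_mod_cast this)
      have : z.1.1 ^ p ^ k = 1 := congrArg (fun w : (g • Q : Sylow p H) => w.1.1) hk
      rw [h, (hodd.pow).neg_one_pow] at this
      exact neg_one_ne_one h2 this
  exact ⟨hy, g, (commuteTransitive H).trans hzs (hzc _ hyP) (hzc _ hxP).symm⟩

theorem mem_fusion_of_parabolic [Finite F] (h2 : (2 : F) ≠ 0) (hH : -1 ∈ H) (h1 : unip 1 ∈ H)
    {y : H} (hy : Parabolic y.1) :
    y ∈ fusion (fun x : H => Scalar x.1) ⟨unip 1, h1⟩ := by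
  have ht1 : tr (unip (1 : F)) = 2 := by simp [tr]; norm_num
  have h4 : (tr y.1 - 2) * (tr y.1 + 2) = 0 := by linear_combination hy.2
  rcases mul_eq_zero.1 h4 with h | h
  · exact mem_fusion_of_trace_two h2 not_scalar_unip_one hy.1 ht1 (by linear_combination h)
  -- Trace `-2` is reduced to trace `2` by changing the sign.
  · let y' : H := ⟨-1, hH⟩ * y
    have hy'v : y'.1 = -y.1 := by simp [y']
    have hy' : ¬ Scalar y'.1 := by
      rw [hy'v]
      intro hs
      apply hy.1
      rcases hs with hs | hs
      · exact Or.inr (by rw [← hs, neg_neg])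
      · exact Or.inl (neg_inj.1 hs)
    have hty' : tr y'.1 = 2 := by
      rw [hy'v]; simp only [tr, neg_ij] at h ⊢; linear_combination -h
    obtain ⟨-, g, hg⟩ := mem_fusion_of_trace_two h2 (x := ⟨unip 1, h1⟩) (y := y')
      not_scalar_unip_one hy' ht1 hty'
    refine ⟨hy.1, g, ?_⟩
    have hg' : Commute (g.1 * y'.1 * g.1⁻¹) (unip 1) := Commute.map hg H.subtype
    rw [hy'v, mul_neg, neg_mul] at hg'
    have := hg'.neg_left
    rw [neg_neg] at this
    exact Subtype.ext this

theorem parabolic_of_mem_fusion {h1 : unip 1 ∈ H} {y : H}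
    (hy : y ∈ fusion (fun x : H => Scalar x.1) ⟨unip 1, h1⟩) : Parabolic y.1 := by
  obtain ⟨hy, g, hg⟩ := hy
  have hg : Commute (g.1 * y.1 * g.1⁻¹) (unip 1) := Commute.map hg H.subtype
  refine ⟨hy, ?_⟩
  rw [← tr_conj g.1 y.1]
  have hd := det_entries (g.1 * y.1 * g.1⁻¹)
  set z := g.1 * y.1 * g.1⁻¹
  obtain ⟨e1, e2, -⟩ := commute_iff.1 hg
  simp only [unip_10, unip_01, unip_00, unip_11] at e1 e2
  unfold tr
  have e1 : z 1 0 = 0 := by simpa using e1.symm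
  have e3 : z 1 1 = z 0 0 := by linear_combination e2
  rw [e1, e3] at hd
  rw [e3]
  linear_combination 4 * hd

/-- The stabilizer in `H` of the line spanned by the first basis vector. -/
def borel (H : Subgroup SL(2, F)) : Subgroup SL(2, F) where
  carrier := {y | y ∈ H ∧ y 1 0 = 0}
  one_mem' := ⟨H.one_mem, rfl⟩
  mul_mem' {a b} ha hb := ⟨H.mul_mem ha.1 hb.1, by rw [mul_10, ha.2, hb.2]; ring⟩
  inv_mem' {a} ha := ⟨H.inv_mem ha.1, by rw [inv_10, ha.2, neg_zero]⟩

theorem borel_le : borel H ≤ H := fun _ h => h.1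

theorem borel_det {y : SL(2, F)} (hy : y ∈ borel H) : y 0 0 * y 1 1 = 1 := by
  have := det_entries y
  rwa [hy.2, mul_zero, sub_zero] at this

/-- The diagonal character of the Borel subgroup. -/
def borelChar (H : Subgroup SL(2, F)) : borel H →* Fˣ where
  toFun y := ⟨y.1 0 0, y.1 1 1, borel_det y.2, by rw [mul_comm]; exact borel_det y.2⟩
  map_one' := by ext; rfl
  map_mul' a b := by
    ext
    change (a.1 * b.1) 0 0 = a.1 0 0 * b.1 0 0
    rw [mul_00, b.2.2]
    ring

theorem borelChar_apply (y : borel H) : (borelChar H y : F) = y.1 0 0 := rfl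

theorem eq_unip {y : SL(2, F)} (h10 : y 1 0 = 0) (h00 : y 0 0 = 1) : y = unip (y 0 1) := by
  have hd := det_entries y
  rw [h10, h00] at hd
  apply ext_entries <;> simp [h10, h00]
  linear_combination hd

theorem card_ker_borelChar : Nat.card (borelChar H).ker = Nat.card (unipSet H) := by
  refine Nat.card_congr
    { toFun := fun y => ⟨y.1.1 0 1, ?_⟩
      invFun := fun a => ⟨⟨unip a.1, a.2, rfl⟩, ?_⟩
      left_inv := ?_
      right_inv := ?_ }
  · have h := congrArg Units.val (MonoidHom.mem_ker.1 y.2)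
    have := eq_unip y.1.2.2 h
    rw [mem_unipSet, ← this]
    exact y.1.2.1
  · rw [MonoidHom.mem_ker]
    ext
    rfl
  · intro y
    have h := congrArg Units.val (MonoidHom.mem_ker.1 y.2)
    exact Subtype.ext (Subtype.ext (eq_unip y.1.2.2 h).symm)
  · intro a
    rfl

theorem card_borel : Nat.card (borel H) =
    Nat.card (unipSet H) * Nat.card (borelChar H).range := by
  rw [← card_ker_borelChar, ← Nat.card_congr
    (QuotientGroup.quotientKerEquivRange (borelChar H)).toEquiv, mul_comm]
  exact Subgroup.card_eq_card_quotient_mul_card_subgroup _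

theorem two_dvd_card_range [Finite F] (h2 : (2 : F) ≠ 0) (hH : -1 ∈ H) :
    2 ∣ Nat.card (borelChar H).range := by
  have hB : -1 ∈ borel H := ⟨hH, by simp⟩
  have hm : (-1 : Fˣ) ∈ (borelChar H).range := ⟨⟨-1, hB⟩, by ext; rw [borelChar_apply]; simp⟩
  have : orderOf (⟨-1, hm⟩ : (borelChar H).range) = 2 := by
    apply orderOf_eq_prime
    · ext1; simp
    · intro h
      have h := congrArg (fun z : (borelChar H).range => (z.1 : F)) h
      simp at h
      exact h2 (by linear_combination -h)
  have h := orderOf_dvd_natCard (⟨-1, hm⟩ : (borelChar H).range)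
  rwa [this] at h

/-- The order of the torus in a Borel subgroup is twice an odd number. -/
theorem exists_odd_card_range [Finite F] (h2 : (2 : F) ≠ 0) (hF : Nat.card F % 4 = 3)
    (hH : -1 ∈ H) : ∃ s, Odd s ∧ Nat.card (borelChar H).range = 2 * s := by
  obtain ⟨s, hs⟩ := two_dvd_card_range h2 hH
  refine ⟨s, ?_, hs⟩
  have h1 := Subgroup.card_subgroup_dvd_card (borelChar H).range
  have h3 := Nat.card_eq_card_units_add_one F
  rw [hs] at h1
  -- An even `s` would make `4` divide `|Fˣ| = |F| - 1`.
  by_contra hcon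
  rw [Nat.not_odd_iff_even] at hcon
  obtain ⟨r, hr⟩ := hcon
  obtain ⟨m, hm⟩ := h1
  rw [hm, hr] at h3
  have : Nat.card F = 4 * (r * m) + 1 := by rw [h3]; ring
  omega

/-- Conjugating `unip 1` by Borel elements puts the squares of all torus values in the unipotent
group, together with `0`. Squaring is at most two-to-one on the torus. -/
theorem card_range_add_two_le [Finite F] (h1 : unip 1 ∈ H) :
    Nat.card (borelChar H).range + 2 ≤ 2 * Nat.card (unipSet H) := by
  classical
  let f : (borelChar H).range →* Fˣ := (powMonoidHom 2).comp (borelChar H).range.subtype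
  have hker : Nat.card f.ker ≤ 2 := by
    have : Set.InjOn (fun z : (borelChar H).range => (z.1 : F)) f.ker :=
      fun a _ b _ h => Subtype.ext (Units.ext h)
    have h3 := Set.ncard_le_ncard_of_injOn (t := ({1, -1} : Set F)) _ (fun z hz => ?_) this
      (Set.toFinite _)
    · rw [← Nat.card_coe_set_eq] at h3
      exact h3.trans (Set.ncard_insert_le _ _ |>.trans (by simp))
    · have hz : z.1 ^ 2 = 1 := MonoidHom.mem_ker.1 hz
      have hz : (z.1 : F) ^ 2 = 1 := by rw [← Units.val_pow_eq_pow_val, hz, Units.val_one]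
      rcases sq_eq_one_iff.1 hz with h | h <;> simp [h]
  have hran : Nat.card f.range + 1 ≤ Nat.card (unipSet H) := by
    have : ((Units.val '' (f.range : Set Fˣ)) ∪ {0}) ⊆ (unipSet H : Set F) := by
      rintro _ (⟨_, ⟨⟨_, ⟨y, rfl⟩⟩, rfl⟩, rfl⟩ | rfl)
      · have hy := H.mul_mem (H.mul_mem y.2.1 h1) (H.inv_mem y.2.1)
        have hd := borel_det y.2
        change unip (((borelChar H y : Fˣ) ^ 2 : Fˣ) : F) ∈ H
        convert hy using 1
        have h10 := y.2.2
        apply ext_entries <;> simp [mul_00, mul_01, mul_10, mul_11, inv_00, inv_01, inv_10,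
          inv_11, h10, borelChar_apply, hd]
        · ring
        · rw [mul_comm]; exact hd.symm
      · exact (unipSet H).zero_mem
    have h3 := Set.ncard_le_ncard this (Set.toFinite _)
    rw [Set.ncard_union_eq (by simp) , Set.ncard_image_of_injective _ Units.val_injective,
      Set.ncard_singleton, ← Nat.card_coe_set_eq, ← Nat.card_coe_set_eq] at h3
    exact h3
  have hmul : Nat.card (borelChar H).range = Nat.card f.ker * Nat.card f.range := by
    rw [← Nat.card_congr (QuotientGroup.quotientKerEquivRange f).toEquiv, mul_comm]
    exact Subgroup.card_eq_card_quotient_mul_card_subgroup _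
  nlinarith

theorem card_inf_centralizer_unip [Finite F] (h2 : (2 : F) ≠ 0) (hH : -1 ∈ H) :
    Nat.card (H ⊓ Subgroup.centralizer {unip 1} : Subgroup SL(2, F)) =
      2 * Nat.card (unipSet H) := by
  have hset : ((H ⊓ Subgroup.centralizer {unip 1} : Subgroup SL(2, F)) : Set SL(2, F)) =
      unip '' (unipSet H : Set F) ∪ (fun a => -unip a) '' (unipSet H : Set F) := by
    ext y
    constructor
    · rintro ⟨hy, hc⟩
      have hc : Commute y (unip 1) := Subgroup.mem_centralizer_singleton_iff.1 hc
      obtain ⟨e1, e2, -⟩ := commute_iff.1 hc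
      simp only [unip_10, unip_01, unip_00, unip_11] at e1 e2
      have e1 : y 1 0 = 0 := by simpa using e1.symm
      have e3 : y 1 1 = y 0 0 := by linear_combination e2
      have hd := det_entries y
      rw [e1, e3] at hd
      have : (y 0 0 - 1) * (y 0 0 + 1) = 0 := by linear_combination hd
      rcases mul_eq_zero.1 this with h | h
      · left
        have e := eq_unip e1 (by linear_combination h)
        exact ⟨y 0 1, by rw [SetLike.mem_coe, mem_unipSet, ← e]; exact hy, e.symm⟩
      · right
        have e := eq_unip (y := -y) (by simp [e1]) (by simp; linear_combination -h)
        have hy' : -y ∈ H := by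
          have := H.mul_mem hH hy
          rwa [neg_one_mul] at this
        exact ⟨(-y) 0 1, by rw [SetLike.mem_coe, mem_unipSet, ← e]; exact hy', by
          simp only; rw [← e, neg_neg]⟩
    · have hcomm : ∀ a : F, Commute (unip a) (unip 1) := by
        intro a
        rw [commute_iff_eq, ← unip_add, ← unip_add, add_comm]
      rintro (⟨a, ha, rfl⟩ | ⟨a, ha, rfl⟩)
      · exact ⟨ha, Subgroup.mem_centralizer_singleton_iff.2 (hcomm a).eq⟩
      · refine ⟨?_, Subgroup.mem_centralizer_singleton_iff.2 (hcomm a).neg_left.eq⟩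
        have := H.mul_mem hH ha
        rwa [neg_one_mul] at this
  have hinj : Function.Injective (unip : F → SL(2, F)) := fun a b h =>
    congrArg (fun z : SL(2, F) => z 0 1) h
  have hcard := congrArg Set.ncard hset
  rwa [Set.ncard_union_eq, Set.ncard_image_of_injective _ hinj,
    Set.ncard_image_of_injective _ (fun a b h => hinj (neg_inj.1 h)), ← two_mul,
    ← Nat.card_coe_set_eq, ← Nat.card_coe_set_eq] at hcard
  rw [Set.disjoint_left]
  rintro _ ⟨a, -, rfl⟩ ⟨b, -, h⟩
  have := congrArg (fun z : SL(2, F) => z 0 0) h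
  simp at this
  exact h2 (by linear_combination -this)

theorem normSet_unip (h1 : unip 1 ∈ H) :
    (normSet (⟨unip 1, h1⟩ : H)).ncard = Nat.card (borel H) := by
  rw [← Set.ncard_image_of_injective _ (Subtype.val_injective (p := (· ∈ H))),
    ← Nat.card_coe_set_eq]
  refine Nat.card_congr (Equiv.setCongr ?_)
  have hiff : ∀ y : SL(2, F), Commute (y * unip 1 * y⁻¹) (unip 1) ↔ y 1 0 = 0 := by
    intro y
    rw [commute_iff]
    simp only [mul_00, mul_01, mul_10, mul_11, inv_00, inv_01, inv_10, inv_11, unip_00, unip_01,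
      unip_10, unip_11]
    constructor
    · rintro ⟨h, -⟩
      have : y 1 0 ^ 2 = 0 := by linear_combination h
      simpa using this
    · intro h
      rw [h]
      refine ⟨by ring, by ring, by ring⟩
  ext y
  constructor
  · rintro ⟨z, hz, rfl⟩
    exact ⟨z.2, (hiff z).1 (Commute.map hz H.subtype)⟩
  · rintro ⟨hy, h0⟩
    exact ⟨⟨y, hy⟩, Subtype.ext ((hiff y).2 h0), rfl⟩

/-- A noncentral semisimple element of the Borel subgroup has a full torus as centralizer. -/
theorem card_inf_centralizer_of_mem_borel [Finite F] {x : SL(2, F)} (hx : x ∈ borel H)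
    (hxd : x 0 0 ^ 2 ≠ 1) :
    Nat.card (H ⊓ Subgroup.centralizer {x} : Subgroup SL(2, F)) =
      Nat.card (borelChar H).range := by
  have hdx := borel_det hx
  have hx10 := hx.2
  have hne : x 0 0 - x 1 1 ≠ 0 := by
    intro h
    apply hxd
    linear_combination hdx + x 0 0 * h
  have hmem : ∀ c ∈ H ⊓ Subgroup.centralizer {x}, c ∈ borel H := by
    rintro c ⟨hc, hcx⟩
    have hcx : Commute c x := Subgroup.mem_centralizer_singleton_iff.1 hcx
    obtain ⟨-, -, e⟩ := commute_iff.1 hcx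
    rw [hx10, mul_zero] at e
    refine ⟨hc, ?_⟩
    have : (x 0 0 - x 1 1) * c 1 0 = 0 := by linear_combination e
    exact (mul_eq_zero.1 this).resolve_left hne
  refine Nat.card_congr (Equiv.ofBijective
    (fun c => ⟨borelChar H ⟨c.1, hmem c.1 c.2⟩, ⟨_, rfl⟩⟩) ⟨?_, ?_⟩)
  · intro c c' h
    have h00 : c.1 0 0 = c'.1 0 0 := congrArg (fun z : (borelChar H).range => (z.1 : F)) h
    have hb := hmem c.1 c.2
    have hb' := hmem c'.1 c'.2
    have h11 : c.1 1 1 = c'.1 1 1 := by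
      have e1 := borel_det hb
      have e2 := borel_det hb'
      rw [h00] at e1
      exact mul_left_cancel₀ (left_ne_zero_of_mul_eq_one e2) (e1.trans e2.symm)
    have k1 := (commute_iff.1 (Subgroup.mem_centralizer_singleton_iff.1 c.2.2 : Commute c.1 x)).2.1
    have k2 := (commute_iff.1 (Subgroup.mem_centralizer_singleton_iff.1 c'.2.2 : Commute c'.1 x)).2.1
    rw [h00, h11] at k1
    apply Subtype.ext
    apply ext_entries h00 _ (by rw [hb.2, hb'.2]) h11
    apply mul_left_cancel₀ hne
    rw [k1, k2]
  · rintro ⟨_, ⟨y, rfl⟩⟩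
    -- The commutator of `x` with `unip a` is `unip ((x₀₀² - 1) a)`, so by finiteness every
    -- unipotent element of `H` arises. Hence each `y` in the Borel subgroup can be multiplied by
    -- some `unip a` so as to commute with `x`, which gives surjectivity of the diagonal character
    -- on the centralizer.
    have hinj : Function.Injective (fun a : unipSet H => (⟨(x 0 0 ^ 2 - 1) * a.1, by
        have := H.mul_mem (H.mul_mem (H.mul_mem hx.1 a.2) (H.inv_mem hx.1)) (H.inv_mem a.2)
        rw [mem_unipSet]
        convert this using 1
        rw [← unip_neg]
        apply ext_entries <;> simp [mul_00, mul_01, mul_10, mul_11, inv_00, inv_01, inv_10,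
          inv_11, hx10]
        · rw [hdx]
        · linear_combination (a : F) * hdx
        · linear_combination -hdx⟩ : unipSet H)) := by
      intro a b h
      have h := congrArg Subtype.val h
      exact Subtype.ext (mul_left_cancel₀ (sub_ne_zero.2 hxd) h)
    have hsurj := Finite.surjective_of_injective hinj
    have hz := H.mul_mem (H.mul_mem (H.mul_mem y.2.1 hx.1) (H.inv_mem y.2.1)) (H.inv_mem hx.1)
    have hdy := borel_det y.2
    have hy10 := y.2.2
    have hzu := eq_unip (y := y.1 * x * y.1⁻¹ * x⁻¹)
      (by simp [mul_10, mul_11, inv_00, inv_10, hx10, hy10])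
      (by
        simp [mul_00, mul_01, inv_00, inv_10, hx10, hy10]
        linear_combination x 0 0 * x 1 1 * hdy + hdx)
    obtain ⟨a, ha⟩ := hsurj ⟨(y.1 * x * y.1⁻¹ * x⁻¹) 0 1, by rw [mem_unipSet, ← hzu]; exact hz⟩
    have ha := congrArg Subtype.val ha
    simp [mul_00, mul_01, inv_00, inv_01, inv_10, inv_11, hx10, hy10] at ha
    have hcomm : Commute (unip a.1 * y.1) x := by
      rw [commute_iff]
      simp only [mul_00, mul_01, mul_10, mul_11, hx10, hy10, unip_00, unip_01, unip_10, unip_11]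
      refine ⟨by ring, ?_, by ring⟩
      grind
    refine ⟨⟨unip a.1 * y.1, H.mul_mem a.2 y.2.1,
      Subgroup.mem_centralizer_singleton_iff.2 hcomm.eq⟩, ?_⟩
    apply Subtype.ext
    ext
    change (unip a.1 * y.1) 0 0 = y.1 0 0
    simp [mul_00, hy10]

end SpecialLinearTwo

/-! ### The orbit of infinity. -/

namespace SpecialLinearTwo

open Matrix MatrixGroups CommuteTransitive

variable {F : Type*} [Field F] {H : Subgroup SL(2, F)}

/-- Cosets of the Borel subgroup are points of the orbit of infinity. Infinity itself and the
translates of `0 = g ∞` by the unipotent group are distinct points; in case of equality there are no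
others. -/
theorem card_unipSet_lt_relIndex [Finite F] {g : SL(2, F)} (hg : g ∈ H) (hg0 : g 0 0 = 0) :
    Nat.card (unipSet H) + 1 ≤ (borel H).relIndex H ∧
    ((borel H).relIndex H = Nat.card (unipSet H) + 1 →
      ∀ y ∈ H, y 1 0 ≠ 0 → ∃ a ∈ unipSet H, y 0 0 = a * y 1 0) := by
  have hs : g 1 0 ≠ 0 := by
    intro h
    have := det_entries g
    simp [hg0, h] at this
  have heq : ∀ x y : H, (x : H ⧸ (borel H).subgroupOf H) = y ↔
      x.1 0 0 * y.1 1 0 = x.1 1 0 * y.1 0 0 := by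
    intro x y
    rw [QuotientGroup.eq, Subgroup.mem_subgroupOf]
    have : ((x⁻¹ * y : H) : SL(2, F)) 1 0 = -x.1 1 0 * y.1 0 0 + x.1 0 0 * y.1 1 0 := by
      rw [Subgroup.coe_mul, mul_10, Subgroup.coe_inv, inv_10, inv_11]
    constructor
    · intro h
      have h := h.2
      rw [this] at h
      linear_combination h
    · intro h
      refine ⟨(x⁻¹ * y).2, ?_⟩
      rw [this]
      linear_combination h
  let f : Option (unipSet H) → H ⧸ (borel H).subgroupOf H := fun o =>
    o.elim ((1 : H) : H ⧸ (borel H).subgroupOf H)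
      fun a => ((⟨unip a.1, a.2⟩ * ⟨g, hg⟩ : H) : H ⧸ (borel H).subgroupOf H)
  have e0 : ∀ a : unipSet H, ((⟨unip a.1, a.2⟩ * ⟨g, hg⟩ : H) : SL(2, F)) 0 0 = a * g 1 0 := by
    intro a
    rw [Subgroup.coe_mul, mul_00, unip_00, unip_01, hg0]
    ring
  have e1 : ∀ a : unipSet H, ((⟨unip a.1, a.2⟩ * ⟨g, hg⟩ : H) : SL(2, F)) 1 0 = g 1 0 := by
    intro a
    rw [Subgroup.coe_mul, mul_10, unip_10, unip_11]
    ring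
  have hinj : Function.Injective f := by
    rintro (_ | a) (_ | b) h
    · rfl
    · have h := (heq _ _).1 h
      rw [e0, e1] at h
      simp [hs] at h
    · have h := (heq _ _).1 h
      rw [e0, e1] at h
      simp at h
      exact absurd h.symm hs
    · have h := (heq _ _).1 h
      rw [e0, e0, e1, e1] at h
      congr 1
      apply Subtype.ext
      apply mul_right_cancel₀ (mul_ne_zero hs hs)
      linear_combination h
  have hc : Nat.card (Option (unipSet H)) = Nat.card (unipSet H) + 1 := Finite.card_option
  have hn : Nat.card (H ⧸ (borel H).subgroupOf H) = (borel H).relIndex H := rfl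
  refine ⟨?_, fun h y hy hy0 => ?_⟩
  · rw [← hc, ← hn]
    exact Nat.card_le_card_of_injective f hinj
  · rw [← hc, ← hn] at h
    have hbij := (Nat.bijective_iff_injective_and_card f).2 ⟨hinj, h.symm⟩
    obtain ⟨o, ho⟩ := hbij.2 ((⟨y, hy⟩ : H) : H ⧸ (borel H).subgroupOf H)
    rcases o with _ | a
    · have ho := (heq _ _).1 ho
      simp [hy0] at ho
    · have ho := (heq _ _).1 ho
      rw [e0, e1] at ho
      refine ⟨a, a.2, ?_⟩
      apply mul_left_cancel₀ hs
      linear_combination -ho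

/-- `H` has exactly one more Sylow subgroup for the characteristic than the order of this
subgroup. -/
theorem relIndex_borel [Finite F] (h2 : (2 : F) ≠ 0) (hF : Nat.card F % 4 = 3) (hH : -1 ∈ H)
    (h1 : unip 1 ∈ H) {g : SL(2, F)} (hg : g ∈ H) (hg0 : g 0 0 = 0) :
    (borel H).relIndex H = Nat.card (unipSet H) + 1 := by
  classical
  obtain ⟨s, hsodd, hs⟩ := exists_odd_card_range h2 hF hH
  have hsN := card_range_add_two_le h1
  have hn := (card_unipSet_lt_relIndex hg hg0).1
  have hcardH := card_mul_relIndex (borel_le (H := H))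
  rw [card_borel, hs] at hcardH
  have hcardC := card_inf_centralizer_unip h2 hH
  have hnorm := normSet_unip h1
  rw [card_borel, hs] at hnorm
  set N := Nat.card (unipSet H) with hN
  set n := (borel H).relIndex H with hn'
  have hNF : N ∣ Nat.card F := AddSubgroup.card_addSubgroup_dvd_card _
  have hNodd : Odd N := by
    apply Odd.of_dvd_nat _ hNF
    rw [Nat.odd_iff]; omega
  have hs0 : 0 < s := hsodd.pos
  have hN3 : 3 ≤ N := by
    obtain ⟨k, hk⟩ := hNodd
    omega
  set v : H := ⟨unip 1, h1⟩ with hv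
  have hvns : ¬ Scalar v.1 := not_scalar_unip_one
  -- The representatives must include `v`, for the unipotent class, and, unless `s = 1`, a
  -- semisimple element of the Borel subgroup, whose centralizer has order `2 * s`.
  obtain ⟨S, hvS, hSns, hSdisj, hSpar, hSmem⟩ : ∃ S : Finset H, v ∈ S ∧ (∀ x ∈ S, ¬ Scalar x.1) ∧
      (S : Set H).PairwiseDisjoint (fusion (fun x : H => Scalar x.1)) ∧
      (∀ x ∈ S, x ≠ v → ¬ Parabolic x.1) ∧
      (s ≠ 1 → ∃ x ∈ S, x ≠ v ∧
        Nat.card (H ⊓ Subgroup.centralizer {x.1} : Subgroup SL(2, F)) = 2 * s) := by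
    by_cases hs1 : s = 1
    · exact ⟨{v}, by simp, by simpa using hvns, by simp, by simp, fun h => absurd hs1 h⟩
    · have hex : ∃ d : (borelChar H).range, (d.1 : F) ^ 2 ≠ 1 := by
        by_contra! hcon
        have hle : Nat.card (borelChar H).range ≤ 2 := by
          have h3 := Set.ncard_le_ncard_of_injOn (s := (Set.univ : Set (borelChar H).range))
            (t := ({1, -1} : Set F)) (fun z => (z.1 : F))
            (fun z _ => by rcases sq_eq_one_iff.1 (hcon z) with h | h <;> simp [h])
            (fun a _ b _ h => Subtype.ext (Units.ext h)) (Set.toFinite _)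
          rw [Set.ncard_univ] at h3
          exact h3.trans (Set.ncard_insert_le _ _ |>.trans (by simp))
        omega
      obtain ⟨⟨_, ⟨x, rfl⟩⟩, hx⟩ := hex
      have hx : x.1 0 0 ^ 2 ≠ 1 := hx
      have hdx := borel_det x.2
      have hxpar : tr x.1 ^ 2 ≠ 4 := by
        intro h
        have : (x.1 0 0 - x.1 1 1) ^ 2 = 0 := by
          unfold tr at h
          linear_combination h - 4 * hdx
        have : x.1 0 0 - x.1 1 1 = 0 := by simpa using this
        apply hx
        linear_combination hdx + x.1 0 0 * this
      have hxns : ¬ Scalar x.1 := by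
        rintro (h | h) <;> rw [h] at hxpar <;> apply hxpar <;> simp [tr] <;> norm_num
      let w : H := ⟨x.1, x.2.1⟩
      have hwv : w ≠ v := by
        intro h
        apply hxpar
        rw [show x.1 = unip 1 from congrArg Subtype.val h]
        simp [tr]
        norm_num
      refine ⟨{v, w}, by simp, ?_, ?_, ?_, fun _ => ⟨w, by simp, hwv, ?_⟩⟩
      · intro z hz
        rcases Finset.mem_insert.1 hz with rfl | hz
        · exact hvns
        · rw [Finset.mem_singleton.1 hz]; exact hxns
      · rw [Finset.coe_insert, Finset.coe_singleton]
        refine (Set.pairwiseDisjoint_singleton _ _).insert ?_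
        intro z hz _
        rw [Set.mem_singleton_iff.1 hz]
        apply (commuteTransitive H).disjoint_fusion hxns
        intro hfus
        exact hxpar (parabolic_of_mem_fusion hfus).2
      · intro z hz hzv hp
        rcases Finset.mem_insert.1 hz with rfl | hz
        · exact hzv rfl
        · rw [Finset.mem_singleton.1 hz] at hp
          exact hxpar hp.2
      · rw [← hs]
        exact card_inf_centralizer_of_mem_borel x.2 hx
  obtain ⟨R, hSR, hR, hRdisj, hsum⟩ := (commuteTransitive H).exists_representatives S hSns hSdisj
  have hvR : v ∈ R := hSR hvS
  -- All parabolic elements lie in the class of `v`, so the other representatives are semisimple.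
  have hss : ∀ x : R.erase v, tr x.1.1 ^ 2 ≠ 4 := by
    rintro ⟨x, hx⟩ h
    have hxR := Finset.mem_of_mem_erase hx
    have hf := mem_fusion_of_parabolic h2 hH h1 (y := x) ⟨hR x hxR, h⟩
    have hd := hRdisj hvR hxR (Finset.ne_of_mem_erase hx).symm
    exact Set.disjoint_left.1 hd hf (mem_fusion_self (hR x hxR))
  choose t e ht1 ht2 ht3 ht4 using fun x : R.erase v =>
    exists_fusion_density h2 hH (hR x.1 (Finset.mem_of_mem_erase x.2)) (hss x)
  have hfv := (commuteTransitive H).card_fusion_mul_card_normSet hvns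
  have hcv := ncard_commute_not_scalar h2 hH v
  rw [hcardC] at hcv
  rw [hnorm] at hfv
  have hcard := ncard_not_scalar h2 hH
  have hN0 : (0 : ℚ) < N := by
    have : 0 < N := by omega
    exact_mod_cast this
  have hs0' : (0 : ℚ) < s := by exact_mod_cast hs0
  have hn0 : (0 : ℚ) < n := by
    have : 0 < n := by omega
    exact_mod_cast this
  have hcH : (Nat.card H : ℚ) = 2 * (n * N * s) := by
    rw [← hcardH]; push_cast; ring
  have hfv' : ((fusion (fun x : H => Scalar x.1) v).ncard : ℚ) =
      Nat.card H * ((N - 1) / (N * s)) := by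
    have h3 : ((fusion (fun x : H => Scalar x.1) v).ncard : ℚ) * (N * (2 * s)) =
      Nat.card H * {c : H | Commute c v ∧ ¬ Scalar c.1}.ncard := by exact_mod_cast hfv
    have h4 : ({c : H | Commute c v ∧ ¬ Scalar c.1}.ncard : ℚ) + 2 = 2 * N := by
      exact_mod_cast hcv
    rw [show ({c : H | Commute c v ∧ ¬ Scalar c.1}.ncard : ℚ) = 2 * N - 2 by linarith] at h3
    field_simp
    linarith
  have hq : ((N : ℚ) - 1) / (N * s) + ∑ x ∈ (R.erase v).attach, (1 - 1 / (t x : ℚ)) / e x =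
      1 - 1 / (n * N * s) := by
    have hsum' : ((fusion (fun x : H => Scalar x.1) v).ncard : ℚ) +
        ∑ x ∈ (R.erase v).attach, ((fusion (fun x : H => Scalar x.1) x.1).ncard : ℚ) =
        Nat.card H - 2 := by
      rw [Finset.sum_attach (R.erase v) fun x => ((fusion (fun x : H => Scalar x.1) x).ncard : ℚ),
        Finset.add_sum_erase R (fun x => ((fusion (fun x : H => Scalar x.1) x).ncard : ℚ)) hvR,
        ← hcard, ← hsum]
      push_cast
      ring
    simp only [ht4] at hsum'
    rw [hfv', ← Finset.mul_sum, ← mul_add, hcH] at hsum'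
    have hpos : (0 : ℚ) < n * N * s := by positivity
    apply mul_left_cancel₀ (mul_pos two_pos hpos).ne'
    rw [hsum', mul_sub, mul_one, mul_one_div, mul_div_assoc, div_self hpos.ne', mul_one]
  refine ClassEquation.card_conjugates_eq (R.erase v).attach t e hN3 hNodd hsodd (by omega) hn
    (fun x _ => ht2 x) (fun x _ => ht3 x) (fun h => ?_) hq
  obtain ⟨x, hxS, hxv, hx⟩ := hSmem h
  refine ⟨⟨x, Finset.mem_erase.2 ⟨hxv, hSR hxS⟩⟩, Finset.mem_attach _ _, ?_⟩
  have := ht1 ⟨x, Finset.mem_erase.2 ⟨hxv, hSR hxS⟩⟩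
  simp only at this
  omega

theorem exists_generators_of_unip [Finite F] (h2 : (2 : F) ≠ 0) (hF : Nat.card F % 4 = 3)
    (hns : ¬ IsSquare (-1 : F)) (hH : -1 ∈ H) (h1 : unip 1 ∈ H) {g : SL(2, F)} (hg : g ∈ H)
    (hg0 : g 0 0 = 0) : ∃ a b c, Subgroup.closure {-1, a, b, c} = H :=
  exists_generators_of_doubly_transitive h2 hns h1 hH hg hg0
    ((card_unipSet_lt_relIndex hg hg0).2 (relIndex_borel h2 hF hH h1 hg hg0))

end SpecialLinearTwo

/-! ### Subgroups fix a line or have few generators. -/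

namespace SpecialLinearTwo

open Matrix MatrixGroups

variable {F : Type*} [Field F]

/-- The line spanned by `(a, b)` is invariant under `y`. -/
def FixesLine (a b : F) (y : SL(2, F)) : Prop :=
  a * (y 1 0 * a + y 1 1 * b) = b * (y 0 0 * a + y 0 1 * b)

/-- Conjugation by a diagonal matrix with entries `c` and `1`. -/
def scale (c : Fˣ) : SL(2, F) ≃* SL(2, F) where
  toFun y := mk (y 0 0) (y 0 1 * (c⁻¹ : Fˣ)) (y 1 0 * c) (y 1 1) (by
    have := det_entries y
    have hc : ((c⁻¹ : Fˣ) : F) * c = 1 := by simp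
    linear_combination this - y 0 1 * y 1 0 * hc)
  invFun y := mk (y 0 0) (y 0 1 * c) (y 1 0 * (c⁻¹ : Fˣ)) (y 1 1) (by
    have := det_entries y
    have hc : ((c⁻¹ : Fˣ) : F) * c = 1 := by simp
    linear_combination this - y 0 1 * y 1 0 * hc)
  left_inv y := by apply ext_entries <;> simp
  right_inv y := by apply ext_entries <;> simp
  map_mul' x y := by
    have hc : ((c⁻¹ : Fˣ) : F) * c = 1 := by simp
    apply ext_entries <;> simp only [mul_00, mul_01, mul_10, mul_11, mk_00, mk_01, mk_10, mk_11]
    · linear_combination -x 0 1 * y 1 0 * hc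
    · ring
    · ring
    · linear_combination -x 1 0 * y 0 1 * hc

theorem exists_generators_of_map {H : Subgroup SL(2, F)} (φ : SL(2, F) ≃* SL(2, F))
    (hφ : φ (-1) = -1)
    (h : ∃ a b c, Subgroup.closure {-1, a, b, c} = H.map φ.toMonoidHom) :
    ∃ a b c, Subgroup.closure {-1, a, b, c} = H := by
  obtain ⟨a, b, c, h⟩ := h
  refine ⟨φ.symm a, φ.symm b, φ.symm c, ?_⟩
  apply Subgroup.map_injective (f := φ.toMonoidHom) φ.injective
  rw [← h, MonoidHom.map_closure]
  congr 1
  simp [Set.image_insert_eq, hφ]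

theorem fixesLine_of_trace_two {x : SL(2, F)} (ht : tr x = 2) :
    ∃ a b : F, (a ≠ 0 ∨ b ≠ 0) ∧ FixesLine a b x := by
  have hd := det_entries x
  unfold tr at ht
  by_cases h : x 1 0 = 0
  · exact ⟨1, 0, Or.inl one_ne_zero, by simp [FixesLine, h]⟩
  -- This is the first column of `x - 1`, killed by `x - 1` since `(x - 1)² = 0`.
  · refine ⟨x 0 0 - 1, x 1 0, Or.inr h, ?_⟩
    unfold FixesLine
    have h11 : x 1 1 = 2 - x 0 0 := by linear_combination ht
    rw [h11] at hd ⊢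
    linear_combination x 1 0 * hd

/-- Subgroups of `SL₂(F)` containing `-1` which do not fix a line are generated by `-1` and three
elements, if `F` is finite of cardinality congruent to `3` modulo `4`. -/
theorem exists_fixesLine_or_generators [Finite F] (h2 : (2 : F) ≠ 0) (hF : Nat.card F % 4 = 3)
    (hns : ¬ IsSquare (-1 : F)) {H : Subgroup SL(2, F)} (hH : -1 ∈ H) :
    (∃ a b : F, (a ≠ 0 ∨ b ≠ 0) ∧ ∀ y ∈ H, FixesLine a b y) ∨
      ∃ a b c, Subgroup.closure {-1, a, b, c} = H := by
  by_cases hpar : ∃ x ∈ H, Parabolic x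
  swap
  · push Not at hpar
    exact Or.inr (exists_generators_of_not_parabolic h2 hH hpar)
  obtain ⟨x, hx, hxns, htr⟩ : ∃ x ∈ H, ¬ Scalar x ∧ tr x = 2 := by
    obtain ⟨x, hx, hp⟩ := hpar
    have h4 : (tr x - 2) * (tr x + 2) = 0 := by linear_combination hp.2
    rcases mul_eq_zero.1 h4 with h | h
    · exact ⟨x, hx, hp.1, by linear_combination h⟩
    · refine ⟨-x, by simpa using H.mul_mem hH hx, ?_, ?_⟩
      · rintro (hs | hs)
        · exact hp.1 (Or.inr (by rw [← hs, neg_neg]))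
        · exact hp.1 (Or.inl (neg_inj.1 hs))
      · simp only [tr, neg_ij] at h ⊢; linear_combination -h
  obtain ⟨a, b, hab, hfix⟩ := fixesLine_of_trace_two htr
  by_cases hall : ∀ y ∈ H, FixesLine a b y
  · exact Or.inl ⟨a, b, hab, hall⟩
  right
  push Not at hall
  obtain ⟨h, hh, hnf⟩ := hall
  set p := h 0 0 * a + h 0 1 * b with hp
  set q := h 1 0 * a + h 1 1 * b with hq
  have hδ : a * q - b * p ≠ 0 := sub_ne_zero.2 hnf
  -- The basis is the line fixed by `x` and its image under `h`, rescaled to determinant one. In it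
  -- `x` is unitriangular and `h` has zero upper left entry; `scale` then turns the entry of `x`
  -- into `1`.
  let P : SL(2, F) := mk a (p / (a * q - b * p)) b (q / (a * q - b * p)) (by field_simp)
  have hx10 : (P⁻¹ * x * P) 1 0 = 0 := by
    unfold FixesLine at hfix
    simp only [mul_10, mul_11, inv_10, inv_11, P, mk_00, mk_10]
    linear_combination hfix
  have hh00 : (P⁻¹ * h * P) 0 0 = 0 := by
    simp only [mul_00, mul_01, inv_00, inv_01, P, mk_00, mk_01, mk_10, mk_11]
    field_simp
    rw [hp, hq]
    ring
  have hconj : ∀ y, P⁻¹ * y * P = MulAut.conj P⁻¹ y := by intro y; simp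
  have hxtr : tr (P⁻¹ * x * P) = 2 := by
    have := tr_conj P⁻¹ x
    rw [inv_inv] at this
    rw [this, htr]
  have hxs : ¬ Scalar (P⁻¹ * x * P) := by
    have := (Scalar.conj_iff (x := x) P⁻¹).not.2 hxns
    rwa [inv_inv] at this
  have hx00 : (P⁻¹ * x * P) 0 0 = 1 := by
    have hd := det_entries (P⁻¹ * x * P)
    rw [hx10] at hd
    unfold tr at hxtr
    have : ((P⁻¹ * x * P) 0 0 - 1) ^ 2 = 0 := by
      linear_combination (P⁻¹ * x * P) 0 0 * hxtr - hd
    rw [sq_eq_zero_iff] at this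
    linear_combination this
  have hxu := eq_unip hx10 hx00
  have hc : (P⁻¹ * x * P) 0 1 ≠ 0 := by
    intro h0
    rw [h0, unip_zero] at hxu
    exact hxs (Or.inl hxu)
  set c := Units.mk0 _ hc with hcdef
  let φ : SL(2, F) ≃* SL(2, F) := (MulAut.conj P⁻¹).trans (scale c)
  apply exists_generators_of_map φ
  · apply ext_entries <;> simp [φ, scale]
  · refine exists_generators_of_unip h2 hF hns (g := φ h) ?_ ?_ ⟨h, hh, rfl⟩ ?_
    · refine ⟨-1, hH, ?_⟩
      apply ext_entries <;> simp [φ, scale]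
    · refine ⟨x, hx, ?_⟩
      change scale c (MulAut.conj P⁻¹ x) = unip 1
      rw [← hconj, hxu]
      apply ext_entries <;> simp [scale, hcdef]
      exact mul_inv_cancel₀ hc
    · change (MulAut.conj P⁻¹ h) 0 0 = 0
      rw [← hconj, hh00]

end SpecialLinearTwo

/-! ### Orders, Sylow `2`-subgroups and simultaneous diagonalization. -/

namespace SpecialLinearTwo

open Matrix MatrixGroups

variable {F : Type*} [Field F]

theorem mem_center_iff_scalar {x : SL(2, F)} : x ∈ Subgroup.center SL(2, F) ↔ Scalar x := by
  rw [Subgroup.mem_center_iff]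
  refine ⟨fun h => ?_, fun h g => (h.commute g).symm.eq⟩
  obtain ⟨e1, e2, -⟩ := commute_iff.1 (h (unip 1) : Commute (unip 1) x)
  obtain ⟨f1, -, -⟩ := commute_iff.1 (h weyl : Commute weyl x)
  simp at e1 e2 f1
  rw [scalar_iff]
  refine ⟨?_, e1, by linear_combination e2⟩
  rw [e1] at f1
  linear_combination f1

/-- The projection of `SL₂` to `PSL₂`. -/
abbrev proj : SL(2, F) →* ProjectiveSpecialLinearGroup (Fin 2) F :=
  QuotientGroup.mk' (Subgroup.center SL(2, F))

theorem proj_surjective : Function.Surjective (proj (F := F)) := QuotientGroup.mk'_surjective _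

theorem proj_eq_one_iff {x : SL(2, F)} : proj x = 1 ↔ Scalar x := by
  rw [← mem_center_iff_scalar]
  exact QuotientGroup.eq_one_iff x

theorem card_SL2 [Finite F] :
    Nat.card SL(2, F) * (Nat.card F - 1) =
      (Nat.card F ^ 2 - 1) * (Nat.card F ^ 2 - Nat.card F) := by
  classical
  have := Fintype.ofFinite F
  have hGL := Matrix.card_GL_field (𝔽 := F) 2
  rw [Fin.prod_univ_two] at hGL
  simp only [Fin.val_zero, Fin.val_one, pow_zero, pow_one] at hGL
  rw [Nat.card_eq_fintype_card (α := F), ← hGL]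
  let d : GL (Fin 2) F →* Fˣ := GeneralLinearGroup.det
  have hker : Nat.card SL(2, F) = Nat.card d.ker := by
    refine Nat.card_congr (Equiv.ofBijective (fun x => ⟨SpecialLinearGroup.toGL x, ?_⟩) ⟨?_, ?_⟩)
    · rw [MonoidHom.mem_ker]
      ext
      exact x.det_coe
    · intro x y h
      exact SpecialLinearGroup.toGL_injective (congrArg Subtype.val h)
    · rintro ⟨g, hg⟩
      refine ⟨⟨g.1, congrArg Units.val (MonoidHom.mem_ker.1 hg)⟩, ?_⟩
      apply Subtype.ext
      ext
      rfl
  have hsurj : Function.Surjective d := by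
    intro u
    refine ⟨GeneralLinearGroup.mkOfDetNeZero !![(u : F), 0; 0, 1] (by simp), ?_⟩
    ext
    change Matrix.det _ = _
    simp
  have hran : Nat.card Fˣ = Nat.card (GL (Fin 2) F ⧸ d.ker) :=
    Nat.card_congr (QuotientGroup.quotientKerEquivOfSurjective d hsurj).symm.toEquiv
  have hu := Nat.card_eq_card_units_add_one F
  rw [← Nat.card_eq_fintype_card, hu, Nat.add_sub_cancel, hker, hran, mul_comm]
  exact (Subgroup.card_eq_card_quotient_mul_card_subgroup _).symm

theorem card_center [Finite F] (h2 : (2 : F) ≠ 0) :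
    Nat.card (Subgroup.center SL(2, F)) = 2 := by
  have : (Subgroup.center SL(2, F) : Set SL(2, F)) = {1, -1} := by
    ext x
    exact mem_center_iff_scalar
  have h := congrArg Set.ncard this
  rwa [Set.ncard_pair (neg_one_ne_one h2).symm, ← Nat.card_coe_set_eq] at h

theorem two_ne_zero_of_card [Finite F] (hF : Nat.card F % 4 = 3) : (2 : F) ≠ 0 := by
  intro h
  have := Fintype.ofFinite F
  have hc : CharP F 2 := CharTwo.of_one_ne_zero_of_two_eq_zero one_ne_zero h
  obtain ⟨n, hn⟩ := FiniteField.card F 2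
  rw [Nat.card_eq_fintype_card, hn.2] at hF
  have : 2 ∣ 2 ^ (n : ℕ) := dvd_pow_self 2 n.ne_zero
  omega

theorem not_isSquare_neg_one [Finite F] (hF : Nat.card F % 4 = 3) : ¬ IsSquare (-1 : F) := by
  have := Fintype.ofFinite F
  rw [FiniteField.isSquare_neg_one_iff, ← Nat.card_eq_fintype_card]
  omega

theorem not_isSquare_two [Finite F] (hF : Nat.card F % 8 = 3) : ¬ IsSquare (2 : F) := by
  have := Fintype.ofFinite F
  rw [FiniteField.isSquare_two_iff, ← Nat.card_eq_fintype_card]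
  omega

theorem card_PSL2 [Finite F] (hF : Nat.card F % 8 = 3) :
    ∃ m, Odd m ∧ Nat.card (ProjectiveSpecialLinearGroup (Fin 2) F) = 4 * (m * Nat.card F) := by
  have h2 := two_ne_zero_of_card (F := F) (by omega)
  have h1 := Subgroup.card_eq_card_quotient_mul_card_subgroup (Subgroup.center SL(2, F))
  rw [card_center h2] at h1
  have h3 := card_SL2 (F := F)
  obtain ⟨k, hk⟩ : ∃ k, Nat.card F = 8 * k + 3 := ⟨Nat.card F / 8, by omega⟩
  -- For `|F| = 8 k + 3` one has `|F| - 1 = 2 (4 k + 1)` and `|F| + 1 = 4 (2 k + 1)`.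
  refine ⟨(4 * k + 1) * (2 * k + 1), ⟨4 * k ^ 2 + 3 * k, by ring⟩, ?_⟩
  set Q := Nat.card F
  set c := Nat.card (ProjectiveSpecialLinearGroup (Fin 2) F)
  have e1 : Q - 1 = 2 * (4 * k + 1) := by omega
  have e2 : Q ^ 2 - 1 = 8 * (4 * k + 1) * (2 * k + 1) := by
    rw [hk]
    apply Nat.sub_eq_of_eq_add
    ring
  have e3 : Q ^ 2 - Q = Q * (2 * (4 * k + 1)) := by
    apply Nat.sub_eq_of_eq_add
    rw [hk]
    ring
  rw [e1, e2, e3, h1] at h3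
  have e4 : 0 < 4 * (4 * k + 1) := by omega
  apply Nat.eq_of_mul_eq_mul_right e4
  change c * 2 * (2 * (4 * k + 1)) = _ at h3
  calc c * (4 * (4 * k + 1)) = c * 2 * (2 * (4 * k + 1)) := by ring
    _ = _ := h3
    _ = _ := by ring

theorem card_sylow_two [Finite F] (hF : Nat.card F % 8 = 3)
    (P : Sylow 2 (ProjectiveSpecialLinearGroup (Fin 2) F)) : Nat.card P = 4 := by
  obtain ⟨m, hm, hc⟩ := card_PSL2 hF
  have hodd : Odd (m * Nat.card F) := hm.mul (by rw [Nat.odd_iff]; omega)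
  have h0 : m * Nat.card F ≠ 0 := by
    intro h
    rw [h] at hodd
    exact absurd hodd (by decide)
  rw [P.card_eq_multiplicity, hc, Nat.factorization_mul (by norm_num) h0, Finsupp.add_apply,
    Nat.factorization_eq_zero_of_not_dvd (n := m * Nat.card F) (p := 2)
      (by rw [← even_iff_two_dvd, Nat.not_even_iff_odd]; exact hodd),
    show (4 : ℕ) = 2 ^ 2 by norm_num, Nat.factorization_pow, Finsupp.smul_apply,
    Nat.Prime.factorization_self Nat.prime_two]
  rfl

theorem sq_entries (x : SL(2, F)) : (x ^ 2) 0 0 = x 0 0 * tr x - 1 ∧ (x ^ 2) 0 1 = x 0 1 * tr x ∧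
    (x ^ 2) 1 0 = x 1 0 * tr x ∧ (x ^ 2) 1 1 = x 1 1 * tr x - 1 := by
  have hd := det_entries x
  unfold tr
  rw [sq]
  refine ⟨?_, ?_, ?_, ?_⟩ <;> simp only [mul_00, mul_01, mul_10, mul_11]
  · linear_combination -hd
  · ring
  · ring
  · linear_combination -hd

theorem tr_eq_zero_of_scalar_sq {x : SL(2, F)} (hx : ¬ Scalar x) (h : Scalar (x ^ 2)) :
    tr x = 0 := by
  rw [scalar_iff] at h
  obtain ⟨e1, e2, e3, e4⟩ := sq_entries x
  rw [e1, e2, e3, e4] at h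
  obtain ⟨h1, h2, h3⟩ := h
  rcases not_scalar_iff.1 hx with k | k | k
  · exact (mul_eq_zero.1 h1).resolve_left k
  · exact (mul_eq_zero.1 h2).resolve_left k
  · exact (mul_eq_zero.1 (by linear_combination h3 :
      (x 0 0 - x 1 1) * tr x = 0)).resolve_left k

theorem scalar_sq_of_tr_eq_zero {x : SL(2, F)} (h : tr x = 0) : x ^ 2 = -1 := by
  obtain ⟨e1, e2, e3, e4⟩ := sq_entries x
  apply ext_entries <;> simp only [e1, e2, e3, e4, h, neg_ij, one_00, one_01, one_10, one_11] <;>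
    ring

/-- Otherwise `x ^ 2` has trace zero; as this trace is `(tr x)² - 2`, `2` would be a square. So
`PSL₂` has no element of order 4. -/
theorem scalar_sq_of_scalar_pow_four (hns : ¬ IsSquare (2 : F)) {x : SL(2, F)}
    (h : Scalar (x ^ 4)) : Scalar (x ^ 2) := by
  by_contra hx
  have h0 := tr_eq_zero_of_scalar_sq hx (by rwa [← pow_mul])
  obtain ⟨e1, -, -, e4⟩ := sq_entries x
  apply hns
  refine ⟨tr x, ?_⟩
  unfold tr at *
  rw [e1, e4] at h0
  linear_combination -h0

theorem sylow_two_sq [Finite F] (hF : Nat.card F % 8 = 3)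
    (P : Sylow 2 (ProjectiveSpecialLinearGroup (Fin 2) F)) :
    ∀ x ∈ P, x ^ 2 = 1 := by
  intro x hx
  have h4 : x ^ 4 = 1 := by
    have hc : Nat.card {x // x ∈ P} = 4 := card_sylow_two hF P
    have := pow_card_eq_one' (x := (⟨x, hx⟩ : P))
    rw [hc] at this
    exact congrArg Subtype.val this
  obtain ⟨y, rfl⟩ := proj_surjective x
  rw [← map_pow, proj_eq_one_iff] at h4 ⊢
  exact scalar_sq_of_scalar_pow_four (not_isSquare_two hF) h4

theorem sylow_two_comm [Finite F] (hF : Nat.card F % 8 = 3)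
    (P : Sylow 2 (ProjectiveSpecialLinearGroup (Fin 2) F)) :
    ∀ x ∈ P, ∀ y ∈ P, x * y = y * x := by
  have hinv : ∀ x ∈ P, x⁻¹ = x := fun x hx =>
    inv_eq_of_mul_eq_one_left (by rw [← sq]; exact sylow_two_sq hF P x hx)
  intro x hx y hy
  have := hinv _ (P.mul_mem hx hy)
  rw [_root_.mul_inv_rev, hinv x hx, hinv y hy] at this
  exact this.symm

/-- Elements fixing a given line and inverted by a given involution are simultaneously
diagonalizable. -/
theorem exists_diagonalizer (hns : ¬ IsSquare (-1 : F)) {σ : SL(2, F)} (hσ : tr σ = 0) {a b : F}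
    (hab : a ≠ 0 ∨ b ≠ 0) :
    ∃ P : SL(2, F), ∀ ξ, FixesLine a b ξ → σ * ξ = ξ⁻¹ * σ → ∃ d : Fˣ, P⁻¹ * ξ * P = diag d := by
  have hd := det_entries σ
  have hσ11 : σ 1 1 = -σ 0 0 := by unfold tr at hσ; linear_combination hσ
  rw [hσ11] at hd
  set p := σ 0 0 * a + σ 0 1 * b with hp
  set q := σ 1 0 * a - σ 0 0 * b with hq
  -- If `σ` fixed the line, its eigenvalue there would be a square root of `-1`, because `σ² = -1`.
  have hδ : a * q - b * p ≠ 0 := by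
    intro h
    rcases hab with h0 | h0
    · have : p ^ 2 = -a ^ 2 := by
        rw [hp, hq] at *
        linear_combination -σ 0 1 * h - a ^ 2 * hd
      exact hns ⟨p / a, by field_simp; linear_combination -this⟩
    · have : q ^ 2 = -b ^ 2 := by
        rw [hp, hq] at *
        linear_combination σ 1 0 * h - b ^ 2 * hd
      exact hns ⟨q / b, by field_simp; linear_combination -this⟩
  refine ⟨mk a (p / (a * q - b * p)) b (q / (a * q - b * p)) (by field_simp), fun ξ hf hinv => ?_⟩
  set P : SL(2, F) := mk a (p / (a * q - b * p)) b (q / (a * q - b * p)) (by field_simp) with hP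
  have E1 : a * (ξ 1 0 * a + ξ 1 1 * b) = b * (ξ 0 0 * a + ξ 0 1 * b) := hf
  have E2 := congrArg (fun z : SL(2, F) => z 0 0) hinv
  simp only [mul_00, inv_00, inv_01] at E2
  -- Since `σ ξ = ξ⁻¹ σ`, the image of the given line under `σ` is fixed too. The basis depends only
  -- on `σ` and the line, so one `P` serves all `ξ`.
  have E3 : p * (ξ 1 0 * p + ξ 1 1 * q) - q * (ξ 0 0 * p + ξ 0 1 * q) = 0 := by
    rw [hp, hq]
    linear_combination -E1 +
      (-σ 1 0 * a ^ 2 + 2 * σ 0 0 * a * b + σ 0 1 * b ^ 2) * E2 -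
      (a * (ξ 1 0 * a + ξ 1 1 * b) - b * (ξ 0 0 * a + ξ 0 1 * b)) * (hd)
  have h10 : (P⁻¹ * ξ * P) 1 0 = 0 := by
    simp only [mul_10, mul_11, inv_10, inv_11, P, mk_00, mk_10]
    linear_combination E1
  have h01 : (P⁻¹ * ξ * P) 0 1 = 0 := by
    simp only [mul_00, mul_01, inv_00, inv_01, P, mk_01, mk_11]
    linear_combination -((a * q - b * p)⁻¹) ^ 2 * E3
  have hdet := det_entries (P⁻¹ * ξ * P)
  rw [h01, zero_mul, sub_zero] at hdet
  have h00 : (P⁻¹ * ξ * P) 0 0 ≠ 0 := left_ne_zero_of_mul_eq_one hdet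
  refine ⟨Units.mk0 _ h00, ?_⟩
  apply ext_entries
  · rfl
  · exact h01
  · exact h10
  · rw [diag_11]
    exact eq_inv_of_mul_eq_one_right hdet

end SpecialLinearTwo

/-! ### Lower bounds for the rank. -/

section Rank

theorem exists_generatedBy {G : Type*} [Group G] [Finite G] :
    ∃ r, 0 < r ∧ ∀ H : Subgroup G, GeneratedBy H r := by
  classical
  refine ⟨Nat.card G, Nat.card_pos, fun H => ?_⟩
  refine ⟨fun i => if (Finite.equivFin G).symm i ∈ H then (Finite.equivFin G).symm i else 1, ?_⟩
  refine le_antisymm ?_ fun x hx => ?_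
  · rw [Subgroup.closure_le]
    rintro _ ⟨i, rfl⟩
    dsimp only
    split_ifs with h
    · exact h
    · exact H.one_mem
  · apply Subgroup.subset_closure
    exact ⟨Finite.equivFin G x, by simp [hx]⟩

theorem le_groupRank {G : Type*} [Group G] [Finite G] {n : ℕ}
    (h : ∀ r, 0 < r → (∀ H : Subgroup G, GeneratedBy H r) → n ≤ r) : n ≤ groupRank G :=
  le_csInf exists_generatedBy fun r hr => h r hr.1 hr.2

/-- The dimension of an elementary abelian subgroup is at most the rank. -/
theorem finrank_le_groupRank {G : Type*} [Group G] [Finite G] {p : ℕ} [Fact p.Prime] {V : Type*}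
    [AddCommGroup V] [Module (ZMod p) V] (ψ : Multiplicative V →* G)
    (hψ : Function.Injective ψ) : Module.finrank (ZMod p) V ≤ groupRank G := by
  refine le_groupRank fun r _ hr => ?_
  obtain ⟨a, ha⟩ := hr ψ.range
  have hmem : ∀ i, ∃ b : V, ψ (Multiplicative.ofAdd b) = a i := by
    intro i
    have : a i ∈ ψ.range := ha ▸ Subgroup.subset_closure ⟨i, rfl⟩
    obtain ⟨b, hb⟩ := this
    exact ⟨b.toAdd, hb⟩
  choose b hb using hmem
  -- Over the prime field, generators of the subgroup `ψ.range` pull back to a spanning set of `V`.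
  have hspan : Submodule.span (ZMod p) (Set.range b) = ⊤ := by
    rw [eq_top_iff]
    intro v _
    let S : Subgroup (Multiplicative V) :=
      (Submodule.span (ZMod p) (Set.range b)).toAddSubgroup.toSubgroup
    have hle : Subgroup.closure (Set.range a) ≤ S.map ψ := by
      rw [Subgroup.closure_le]
      rintro _ ⟨i, rfl⟩
      have hbi : b i ∈ Submodule.span (ZMod p) (Set.range b) := Submodule.subset_span ⟨i, rfl⟩
      exact ⟨Multiplicative.ofAdd (b i), hbi, hb i⟩
    have hv : ψ (Multiplicative.ofAdd v) ∈ Subgroup.closure (Set.range a) := by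
      rw [ha]; exact ⟨_, rfl⟩
    obtain ⟨w, hw, e⟩ := hle hv
    rw [← show Multiplicative.toAdd w = v from hψ e]
    exact hw
  have := finrank_range_le_card (R := ZMod p) b
  rw [Set.finrank, hspan, finrank_top, Fintype.card_fin] at this
  exact this

end Rank

/-! ### Commutators with a Sylow `2`-subgroup of `PSL₂`. -/

namespace SpecialLinearTwo

open Matrix MatrixGroups

variable {F : Type*} [Field F]

/-- Unitriangular matrices, as a homomorphism to `PSL₂`. -/
def unipHom : Multiplicative F →* ProjectiveSpecialLinearGroup (Fin 2) F where
  toFun a := proj (unip a.toAdd)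
  map_one' := by
    rw [toAdd_one, unip_zero, map_one]
  map_mul' a b := by
    rw [toAdd_mul, unip_add, map_mul]

theorem unipHom_injective : Function.Injective (unipHom (F := F)) := by
  rw [injective_iff_map_eq_one]
  intro a ha
  have ha : proj (unip a.toAdd) = 1 := ha
  rw [proj_eq_one_iff, scalar_iff] at ha
  exact ha.1

theorem normal_commutator_top {G : Type*} [Group G] (S : Subgroup G) :
    (⁅(⊤ : Subgroup G), S⁆).Normal := by
  have key : ∀ h, ∀ s ∈ S, h * s * h⁻¹ * s⁻¹ ∈ ⁅(⊤ : Subgroup G), S⁆ := fun h s hs =>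
    Subgroup.commutator_mem_commutator (Subgroup.mem_top h) hs
  refine ⟨fun n hn g => ?_⟩
  rw [Subgroup.commutator_def] at hn
  induction hn using Subgroup.closure_induction with
  | mem x hx =>
    obtain ⟨h, -, s, hs, rfl⟩ := hx
    -- The identity is `g [h, s] g⁻¹ = [g h, s] [g, s]⁻¹`.
    have e : g * (h * s * h⁻¹ * s⁻¹) * g⁻¹ =
        g * h * s * (g * h)⁻¹ * s⁻¹ * (g * s * g⁻¹ * s⁻¹)⁻¹ := by group
    exact e ▸ Subgroup.mul_mem _ (key (g * h) s hs) (Subgroup.inv_mem _ (key g s hs))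
  | one => simp
  | mul x y _ _ hx hy =>
    have := Subgroup.mul_mem _ hx hy
    convert this using 1
    group
  | inv x _ hx =>
    have := Subgroup.inv_mem _ hx
    convert this using 1
    group

/-- By simplicity the normal subgroup `[G, P]` is trivial or everything. If trivial, `P` would be
central, hence normal of order 4 in a simple group whose order is a proper multiple of 4. -/
theorem commutator_top_sylow [Finite F] (hF : Nat.card F % 8 = 3) (h3 : Nat.card F ≠ 3)
    (P : Sylow 2 (ProjectiveSpecialLinearGroup (Fin 2) F)) :
    ⁅(⊤ : Subgroup (ProjectiveSpecialLinearGroup (Fin 2) F)),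
      (P : Subgroup (ProjectiveSpecialLinearGroup (Fin 2) F))⁆ = ⊤ := by
  have hsimple : IsSimpleGroup (ProjectiveSpecialLinearGroup (Fin 2) F) :=
    ProjectiveSpecialLinearGroup.rank_two_simple (by omega)
  have hn := normal_commutator_top (P : Subgroup (ProjectiveSpecialLinearGroup (Fin 2) F))
  refine hn.eq_bot_or_eq_top.resolve_left fun hbot => ?_
  rw [Subgroup.commutator_eq_bot_iff_le_centralizer] at hbot
  have hc := card_sylow_two hF P
  have hP : (P : Subgroup (ProjectiveSpecialLinearGroup (Fin 2) F)).Normal := by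
    refine ⟨fun n hn g => ?_⟩
    have := Subgroup.mem_centralizer_iff.1 (hbot (Subgroup.mem_top g)) n hn
    rw [← this, mul_inv_cancel_right]
    exact hn
  rcases hP.eq_bot_or_eq_top with h | h
  · have h1 : Nat.card (P : Subgroup (ProjectiveSpecialLinearGroup (Fin 2) F)) = 1 := by
      rw [h]; exact Subgroup.card_bot
    have : Nat.card (P : Subgroup (ProjectiveSpecialLinearGroup (Fin 2) F)) = 4 := hc
    omega
  · have h1 : Nat.card (P : Subgroup (ProjectiveSpecialLinearGroup (Fin 2) F)) =
      Nat.card (ProjectiveSpecialLinearGroup (Fin 2) F) := by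
      rw [h]; exact Subgroup.card_top
    have h4 : Nat.card (P : Subgroup (ProjectiveSpecialLinearGroup (Fin 2) F)) = 4 := hc
    obtain ⟨m, -, hm⟩ := card_PSL2 hF
    rw [← h1, h4] at hm
    have : Nat.card F ∣ 1 := ⟨m, by linarith⟩
    have := Nat.le_of_dvd one_pos this
    omega

/-- A subgroup generated by commutators with the Sylow subgroup and fixing a line is generated by
one element for each involution of the Sylow subgroup. -/
theorem generatedBy_of_fixesLine [Finite F] (hF : Nat.card F % 8 = 3)
    (P : Sylow 2 (ProjectiveSpecialLinearGroup (Fin 2) F))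
    {X : Set (ProjectiveSpecialLinearGroup (Fin 2) F)} (hX : X ⊆ commSet (P : Subgroup (ProjectiveSpecialLinearGroup (Fin 2) F)))
    {a b : F} (hab : a ≠ 0 ∨ b ≠ 0) (hfix : ∀ y, proj y ∈ X → FixesLine a b y) :
    GeneratedBy (Subgroup.closure X) 3 := by
  classical
  have hns := not_isSquare_neg_one (F := F) (by omega)
  -- Sort the generators by the element of `P` that produces them; each nontrivial one contributes a
  -- cyclic group.
  let Y : P → Set (ProjectiveSpecialLinearGroup (Fin 2) F) := fun s =>
    {x | x ∈ X ∧ ∃ g, x = g⁻¹ * (s.1⁻¹ * g * s.1)}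
  have hcyc : ∀ s : P, s ≠ 1 → ∃ c, Subgroup.zpowers c = Subgroup.closure (Y s) := by
    intro s hs
    obtain ⟨σ, hσ⟩ := proj_surjective s.1
    have hσs : ¬ Scalar σ := by
      rw [← proj_eq_one_iff, hσ]
      exact fun h => hs (Subtype.ext h)
    have hσ2 : Scalar (σ ^ 2) := by
      rw [← proj_eq_one_iff, map_pow, hσ]
      exact sylow_two_sq hF P s.1 s.2
    have htr := tr_eq_zero_of_scalar_sq hσs hσ2
    have hσ2' := scalar_sq_of_tr_eq_zero htr
    obtain ⟨T, hT⟩ := exists_diagonalizer hns htr hab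
    let θ : Fˣ →* ProjectiveSpecialLinearGroup (Fin 2) F :=
      proj.comp ((MulAut.conj T).toMonoidHom.comp diag)
    have hle : Subgroup.closure (Y s) ≤ θ.range := by
      rw [Subgroup.closure_le]
      rintro x ⟨hx, g, hg⟩
      obtain ⟨γ, rfl⟩ := proj_surjective g
      rw [← hσ, ← map_inv, ← map_inv, ← map_mul, ← map_mul, ← map_mul] at hg
      set ξ := γ⁻¹ * (σ⁻¹ * γ * σ) with hξ
      have hσi : σ⁻¹ = -σ := by
        rw [inv_eq_iff_mul_eq_one, mul_neg, ← sq, hσ2', neg_neg]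
      -- From `σ² = -1` the relation holds in `SL(2, F)` itself, not merely up to sign.
      have hinv : σ * ξ = ξ⁻¹ * σ := by
        rw [hξ]
        have e1 : (γ⁻¹ * (σ⁻¹ * γ * σ))⁻¹ * σ = σ⁻¹ * γ⁻¹ * σ * γ * σ := by group
        rw [e1, hσi]
        simp only [mul_neg, neg_mul, mul_assoc]
      obtain ⟨d, hd⟩ := hT ξ (hfix ξ (hg ▸ hx)) hinv
      refine ⟨d, ?_⟩
      change proj (T * diag d * T⁻¹) = x
      rw [← hd, hg]
      congr 1
      group
    have : IsCyclic θ.range := isCyclic_of_surjective θ.rangeRestrict θ.rangeRestrict_surjective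
    have hc : IsCyclic (Subgroup.closure (Y s)) := Subgroup.isCyclic_of_le hle
    exact (Subgroup.isCyclic_iff_exists_zpowers_eq_top _).1 hc
  choose c hc using hcyc
  have hcard : Nat.card {s : P // s ≠ 1} = 3 := by
    have h4 : Nat.card {x // x ∈ P} = 4 := card_sylow_two hF P
    have := Fintype.ofFinite P
    rw [Nat.card_eq_fintype_card, Fintype.card_subtype_compl, Fintype.card_subtype_eq,
      ← Nat.card_eq_fintype_card, h4]
  let E : Fin 3 ≃ {s : P // s ≠ 1} := (Finite.equivFinOfCardEq hcard).symm
  refine ⟨fun i => c (E i).1 (E i).2, le_antisymm ?_ ?_⟩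
  · rw [Subgroup.closure_le]
    rintro _ ⟨i, rfl⟩
    have h1 : c (E i).1 (E i).2 ∈ Subgroup.closure (Y (E i).1) := by
      rw [← hc (E i).1 (E i).2]; exact Subgroup.mem_zpowers _
    exact Subgroup.closure_mono (fun x hx => hx.1) h1
  · rw [Subgroup.closure_le]
    intro x hx
    obtain ⟨g, s, hs, e⟩ := hX hx
    by_cases h1 : s = 1
    · have : x = 1 := by rw [e, h1]; group
      rw [this]
      exact Subgroup.one_mem _
    · have h1' : (⟨s, hs⟩ : P) ≠ 1 := fun h => h1 (congrArg Subtype.val h)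
      have hxY : x ∈ Subgroup.closure (Y ⟨s, hs⟩) := Subgroup.subset_closure ⟨hx, g, e⟩
      rw [← hc _ h1'] at hxY
      refine Subgroup.zpowers_le.2 ?_ hxY
      apply Subgroup.subset_closure
      refine ⟨E.symm ⟨⟨s, hs⟩, h1'⟩, ?_⟩
      simp only [Equiv.apply_symm_apply]

/-- Pass to the full preimage in `SL(2, F)`, where the dichotomy applies; the generator `-1` becomes
trivial in `PSL₂`. -/
theorem commutatorsGeneratedBy_three [Finite F] (hF : Nat.card F % 8 = 3)
    (P : Sylow 2 (ProjectiveSpecialLinearGroup (Fin 2) F)) :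
    CommutatorsGeneratedBy (P : Subgroup (ProjectiveSpecialLinearGroup (Fin 2) F)) 3 := by
  intro X hX
  have hF4 : Nat.card F % 4 = 3 := by omega
  have hH : (-1 : SL(2, F)) ∈ (Subgroup.closure X).comap proj := by
    have : proj (-1 : SL(2, F)) = 1 := proj_eq_one_iff.2 (Or.inr rfl)
    rw [Subgroup.mem_comap, this]
    exact Subgroup.one_mem _
  rcases exists_fixesLine_or_generators (two_ne_zero_of_card hF4) hF4 (not_isSquare_neg_one hF4) hH
    with ⟨a, b, hab, h⟩ | ⟨a, b, c, h⟩
  · exact generatedBy_of_fixesLine hF P hX hab fun y hy => h y (Subgroup.subset_closure hy)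
  · refine ⟨![proj a, proj b, proj c], ?_⟩
    have h1 := congrArg (Subgroup.map proj) h
    rw [Subgroup.map_comap_eq_self_of_surjective proj_surjective, MonoidHom.map_closure] at h1
    have h2 : proj (-1 : SL(2, F)) = 1 := proj_eq_one_iff.2 (Or.inr rfl)
    rw [← h1, Set.image_insert_eq, h2, Subgroup.closure_insert_one]
    congr 1
    simp only [Set.image_insert_eq, Set.image_singleton]
    ext x
    simp
    tauto

end SpecialLinearTwo

/-! ### Specialization to `PSL₂(q^e)` and conclusion. -/

open SpecialLinearTwo

theorem le_groupRank_PSL2 (q : ℕ) [Fact q.Prime] {e : ℕ} (he : e ≠ 0) :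
    e ≤ groupRank (PSL2 q e) := by
  have h := finrank_le_groupRank (p := q) (unipHom (F := GaloisField q e)) unipHom_injective
  rwa [GaloisField.finrank q he] at h

theorem le_groupRank_of_eq_top (q : ℕ) [Fact q.Prime] {e : ℕ} (he : e ≠ 0)
    {H : Subgroup (PSL2 q e)} (hH : H = ⊤) : e ≤ groupRank H := by
  have h := finrank_le_groupRank (p := q)
    ((unipHom (F := GaloisField q e)).codRestrict H fun _ => hH ▸ Subgroup.mem_top _)
    fun x y hxy => unipHom_injective (congrArg Subtype.val hxy)
  rwa [GaloisField.finrank q he] at h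

theorem card_galoisField_mod {q e : ℕ} [Fact q.Prime] (he : e ≠ 0) (h : q ^ e ≡ 3 [MOD 8]) :
    Nat.card (GaloisField q e) % 8 = 3 := by
  rw [GaloisField.card q e he]
  exact h

theorem pow_modEq_three_of_odd {q e : ℕ} (hq : q ≡ 3 [MOD 8]) (he : Odd e) :
    q ^ e ≡ 3 [MOD 8] := by
  obtain ⟨k, rfl⟩ := he
  have h9 : 3 ^ 2 ≡ 1 [MOD 8] := rfl
  calc q ^ (2 * k + 1) ≡ 3 ^ (2 * k + 1) [MOD 8] := hq.pow _
    _ = (3 ^ 2) ^ k * 3 := by rw [pow_succ, pow_mul]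
    _ ≡ 1 ^ k * 3 [MOD 8] := (h9.pow k).mul_right 3
    _ = 3 := by rw [one_pow, one_mul]

/-- The rank of `[G, P]` is at least `e` for `G = PSL₂(q^e)`. -/
theorem le_groupRank_commutator {q e : ℕ} [Fact q.Prime] (hq : q ≡ 3 [MOD 8]) (he : Odd e)
    (P : Sylow 2 (PSL2 q e)) :
    e ≤ groupRank ↥⁅(⊤ : Subgroup (PSL2 q e)), (P : Subgroup (PSL2 q e))⁆ := by
  have he0 : e ≠ 0 := he.pos.ne'
  have hF := card_galoisField_mod he0 (pow_modEq_three_of_odd hq he)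
  by_cases h3 : q ^ e = 3
  -- Simplicity is not available here, but `q ^ e = 3` forces `e = 1`, and the rank is positive by
  -- definition.
  · have hq3 : 3 ≤ q := by
      have : q % 8 = 3 := hq
      omega
    have he1 : e ≤ 1 := by
      by_contra! h
      have h1 : 3 ^ 2 ≤ q ^ e :=
        (Nat.pow_le_pow_left hq3 2).trans (Nat.pow_le_pow_right (by omega) h)
      omega
    exact le_groupRank fun r hr _ => he1.trans hr
  · exact le_groupRank_of_eq_top q he0
      (commutator_top_sylow hF (by rwa [GaloisField.card q e he0]) P)

theorem mainTheorem11 :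
    (∀ (q : ℕ) [Fact q.Prime], q ≡ 3 [MOD 8] →
      (∀ e : ℕ, Odd e →
        q ^ e ≡ 3 [MOD 8] ∧
        ∀ P : Sylow 2 (PSL2 q e),
          -- `P` is elementary abelian of order 4
          (Nat.card P = 4 ∧ (∀ x ∈ P, ∀ y ∈ P, x * y = y * x) ∧ ∀ x ∈ P, x ^ 2 = 1) ∧
          CommutatorsGeneratedBy (P : Subgroup (PSL2 q e)) 3 ∧
          (q ^ e ≠ 3 → ⁅(⊤ : Subgroup (PSL2 q e)), (P : Subgroup (PSL2 q e))⁆ = ⊤) ∧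
          e ≤ groupRank (PSL2 q e) ∧
          e ≤ groupRank ↥⁅(⊤ : Subgroup (PSL2 q e)), (P : Subgroup (PSL2 q e))⁆) ∧
      -- the rank of `[G, P]` is unbounded as `e` grows
      (∀ R : ℕ, ∃ e : ℕ, Odd e ∧ ∀ P : Sylow 2 (PSL2 q e),
        R < groupRank ↥⁅(⊤ : Subgroup (PSL2 q e)), (P : Subgroup (PSL2 q e))⁆)) ∧
    -- for `p = 2`, there is no bound for the rank of `[G, P]` in terms of `r` alone
    ¬ ∃ f : ℕ → ℕ, ∀ r : ℕ, 0 < r → ∀ (G : Type) [Group G] [Finite G] (P : Sylow 2 G),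
        CommutatorsGeneratedBy (P : Subgroup G) r →
        groupRank ↥⁅(⊤ : Subgroup G), (P : Subgroup G)⁆ ≤ f r := by
  refine ⟨fun q _ hq => ⟨fun e he => ?_, fun R => ?_⟩, ?_⟩
  · have he0 : e ≠ 0 := he.pos.ne'
    have hF := card_galoisField_mod he0 (pow_modEq_three_of_odd hq he)
    exact ⟨pow_modEq_three_of_odd hq he, fun P =>
      ⟨⟨card_sylow_two hF P, sylow_two_comm hF P, sylow_two_sq hF P⟩,
        commutatorsGeneratedBy_three hF P,
        fun h3 => commutator_top_sylow hF (by rwa [GaloisField.card q e he0]) P,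
        le_groupRank_PSL2 q he0, le_groupRank_commutator hq he P⟩⟩
  · have he : Odd (2 * R + 1) := odd_two_mul_add_one R
    exact ⟨2 * R + 1, he, fun P =>
      lt_of_lt_of_le (by omega) (le_groupRank_commutator hq he P)⟩
  · rintro ⟨f, hf⟩
    have : Fact (Nat.Prime 3) := Nat.fact_prime_three
    -- The witnesses are `q = 3` and an odd exponent exceeding the alleged bound `f 3`.
    have he : Odd (2 * f 3 + 1) := odd_two_mul_add_one _
    have hF := card_galoisField_mod he.pos.ne'
      (pow_modEq_three_of_odd (q := 3) (Nat.ModEq.refl 3) he)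
    obtain ⟨P⟩ : Nonempty (Sylow 2 (PSL2 3 (2 * f 3 + 1))) := inferInstance
    have h1 := hf 3 (by norm_num) _ P (commutatorsGeneratedBy_three hF P)
    have h2 := le_groupRank_commutator (q := 3) (Nat.ModEq.refl 3) he P
    omega
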